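/- **Setting.** An open cone in $\mathbb R^n$ is a nonempty open set $\Gamma\subset\mathbb R^n$ with $0\notin\Gamma$ such that $ax+by\in\Gamma$ whenever $x,y\in\Gamma$ and $a,b>0$. Its dual cone is $\Gamma^*=\{t\in\mathbb R^n : y\cdot t\ge 0 \text{ for all } y\in\Gamma\}$, and $\Gamma$ is called regular if $\Gamma^*$ has nonempty interior. Let $T_\Gamma=\{x+iy : x\in\mathbb R^n,\ y\in\Gamma\}\subset\mathbb C^n$. For $1<p<\infty$, $H^p(T_\Gamma)$ is the set of holomorphic functions $F$ on $T_\Gamma$ with $\sup_{y\in\Gamma}\int_{\mathbb R^n}|F(x+iy)|^p\,dx<\infty$. The Cauchy–Szegő kernel is $$K(w,\overline z)=\int_{\Gamma^*}e^{2\pi i w\cdot t}\,\overline{e^{2\pi i z\cdot t}}\,dt,\qquad w,z\in T_\Gamma,$$ so that $K(z,\overline z)=\int_{\Gamma^*}e^{-4\pi y\cdot t}\,dt>0$ for $z=x+iy\in T_\Gamma$ and $\Gamma$ regular. Condition (CS$_\infty$) says that for every $y'\in\Gamma$ and $x\in\mathbb R^n$, $$\lim_{\widetilde y\in\overline{y'+\Gamma},\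 |\widetilde y|\to\infty}K(x+i\widetilde y,\overline{x+i\widetilde y})=0 .$$ A polygonal cone is the interior of the convex hull of finitely many rays starting at the origin. A circular cone is a set $\{y : |y-(v\cdot y)v|<\kappa\,(v\cdot y)\}$ with $v\in\mathbb R^n$, $|v|=1$, $\kappa>0$ (a rotation of $\{y : (y_1^2+\dots+y_{n-1}^2)^{1/2}<\kappa y_n\}$). **Theorem 4.3.** Let $\Gamma$ be a regular cone in $\mathbb R^n$. Suppose that (CS$_\infty$) holds, or that $n=2$, or that $\Gamma$ is polygonal, or that $\Gamma$ is circular (so in the last three cases (CS$_\infty$) is not assumed). Let $1<p<\infty$ and $F\in H^p(T_\Gamma)$, and write $z=x+iy$. Then: 1. for every $\beta\in\partial\Gamma$, $\displaystyle\lim_{y\in\Gamma,\ y\to\beta}\frac{|F(z)|}{K(z,\overline z)^{1/p}}=0$ uniformly in $x\in\mathbb R^n$; 2. $\displaystyle\lim_{y\in\Gamma,\ |y|\to\infty}\frac{|F(z)|}{K(z,\overline z)^{1/p}}=0$ uniformly in $x\in\mathbb R^n$; 3. $\displaystyle\lim_{|x|\to\infty}\frac{|F(z)|}{K(z,\overline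 z)^{1/p}}=0$ uniformly in $y\in\Gamma$. -/

import Mathlib

open MeasureTheory Filter Topology

namespace TubeHardy

/-- An open cone in `ℝⁿ`: a nonempty open set that does not contain `0` and is closed under
linear combinations with positive coefficients. -/
structure IsOpenCone {n : ℕ} (Γ : Set (EuclideanSpace ℝ (Fin n))) : Prop where
  isOpen : IsOpen Γ
  nonempty : Γ.Nonempty
  zero_notMem : (0 : EuclideanSpace ℝ (Fin n)) ∉ Γ
  add_mem : ∀ x ∈ Γ, ∀ y ∈ Γ, ∀ a b : ℝ, 0 < a → 0 < b → a • x + b • y ∈ Γ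

/-- The dual cone `Γ* = {t | y · t ≥ 0 for all y ∈ Γ}`. -/
def dualCone {n : ℕ} (Γ : Set (EuclideanSpace ℝ (Fin n))) : Set (EuclideanSpace ℝ (Fin n)) :=
  (ProperCone.innerDual Γ : Set (EuclideanSpace ℝ (Fin n)))

/-- A regular cone: an open cone whose dual cone has nonempty interior. -/
structure IsRegularCone {n : ℕ} (Γ : Set (EuclideanSpace ℝ (Fin n))) : Prop
    extends IsOpenCone Γ where
  interior_dual : (interior (dualCone Γ)).Nonempty

/-- A polygonal cone: the interior of the convex hull of finitely many rays
`{c v | c ≥ 0}`, `v ≠ 0`, emanating from the origin. -/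
def IsPolygonalCone {n : ℕ} (Γ : Set (EuclideanSpace ℝ (Fin n))) : Prop :=
  ∃ S : Finset (EuclideanSpace ℝ (Fin n)), (∀ v ∈ S, v ≠ 0) ∧
    Γ = interior (convexHull ℝ (⋃ v ∈ S, {y | ∃ c : ℝ, 0 ≤ c ∧ y = c • v}))

/-- A circular cone with unit axis vector `v` and aperture `κ > 0`: the points whose component
orthogonal to `v` has norm less than `κ` times the component along `v`. For `v` the last
standard basis vector this is `√(y₁² + ⋯ + yₙ₋₁²) < κ yₙ`; the general case is a
rotation of it. -/
def IsCircularCone {n : ℕ} (Γ : Set (EuclideanSpace ℝ (Fin n))) : Prop :=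
  ∃ (v : EuclideanSpace ℝ (Fin n)) (κ : ℝ), ‖v‖ = 1 ∧ 0 < κ ∧
    Γ = {y | ‖y - (inner ℝ v y) • v‖ < κ * inner ℝ v y}

/-- The point `x + i y` of `ℂⁿ`. -/
def cpoint {n : ℕ} (x y : EuclideanSpace ℝ (Fin n)) : EuclideanSpace ℂ (Fin n) :=
  WithLp.toLp 2 fun j => (x j : ℂ) + Complex.I * (y j : ℂ)

/-- The tube `T_Γ = {x + i y | x ∈ ℝⁿ, y ∈ Γ}`. -/
def tube {n : ℕ} (Γ : Set (EuclideanSpace ℝ (Fin n))) : Set (EuclideanSpace ℂ (Fin n)) :=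
  {z | ∃ x y, y ∈ Γ ∧ z = cpoint x y}

/-- Membership in the Hardy space `Hᵖ(T_Γ)`: holomorphic on the tube, with
`sup_{y ∈ Γ} ∫ |F(x + i y)|ᵖ dx < ∞`. -/
structure MemHardy {n : ℕ} (p : ℝ) (Γ : Set (EuclideanSpace ℝ (Fin n)))
    (F : EuclideanSpace ℂ (Fin n) → ℂ) : Prop where
  holomorphic : DifferentiableOn ℂ F (tube Γ)
  bounded : (⨆ y ∈ Γ, ∫⁻ x : EuclideanSpace ℝ (Fin n), ‖F (cpoint x y)‖ₑ ^ p) < ⊤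

/-- The Cauchy–Szegő kernel of the tube,
`K(w, z̄) = ∫_{Γ*} e^{2π i w · t} * conj (e^{2π i z · t}) dt`; here `cauchySzego Γ w z` stands
for `K(w, z̄)`. -/
noncomputable def cauchySzego {n : ℕ} (Γ : Set (EuclideanSpace ℝ (Fin n)))
    (w z : EuclideanSpace ℂ (Fin n)) : ℂ :=
  ∫ t in dualCone Γ,
    Complex.exp (2 * Real.pi * Complex.I * ∑ j, w j * (t j : ℂ)) *
      (starRingEnd ℂ) (Complex.exp (2 * Real.pi * Complex.I * ∑ j, z j * (t j : ℂ)))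

/-- The kernel tends to `0` at infinity in every shifted cone: for all `y' ∈ Γ` and `x`,
`K(x + i y, conj (x + i y)) → 0` as `|y| → ∞`, `y ∈ closure (y' + Γ)`. -/
def KernelVanishesAtInfinity {n : ℕ} (Γ : Set (EuclideanSpace ℝ (Fin n))) : Prop :=
  ∀ y' ∈ Γ, ∀ x : EuclideanSpace ℝ (Fin n),
    Tendsto (fun y => cauchySzego Γ (cpoint x y) (cpoint x y))
      (Bornology.cobounded (EuclideanSpace ℝ (Fin n)) ⊓ 𝓟 (closure ((fun v => y' + v) '' Γ)))
      (𝓝 0)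

/-- The quotient `|F(z)| / K(z, z̄)^{1/p}` (on the diagonal the kernel is real and positive). -/
noncomputable def kernelRatio {n : ℕ} (p : ℝ) (Γ : Set (EuclideanSpace ℝ (Fin n)))
    (F : EuclideanSpace ℂ (Fin n) → ℂ) (z : EuclideanSpace ℂ (Fin n)) : ℝ :=
  ‖F z‖ / (cauchySzego Γ z z).re ^ (1 / p)

end TubeHardy

/-! ### Open cones and their duals. -/

namespace TubeHardy

open scoped Pointwise

variable {n : ℕ} {Γ : Set (EuclideanSpace ℝ (Fin n))}

/-! Write `K(y)` for the diagonal kernel, which depends only on `y`. Everything follows from one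
estimate (`exists_norm_le_add_decay`): for every `κ > 0` there is `B` with `|F(x+iy)| ≤ κ K(y)^{1/p}
+ B (1+|x|+|y|)^{-(n+1)}` on the tube. Since `K` tends to infinity at the boundary and `K(y) ≥ c
(1+|y|)^{-n}`, the last term is negligible against `K(y)^{1/p}` in each of the three limits.

The estimate rests on a pointwise bound `|F|^p ≤ A K(y) M`, where `M` bounds the slice integrals and
`A` depends only on `n` and `p` (`exists_pointwise_bound`). It comes from the mean value property
over a region fitted to the cone at `y`: an Auerbach basis of the slice `{t ∈ Γ* : y·t = 1}`, with
determinant `d`, gives a parallelepiped about `y` inside `Γ` of volume comparable to `1/d`, while `d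
≤ C K(y)`. A function of small Hardy norm is therefore at most a small multiple of `K^{1/p}`.

It remains to approximate `F` in Hardy norm by a rapidly decaying function. The slice norms decrease
along the cone (`lintegral_slice_add_le`), so, by uniform convexity, the slices along a ray to the
vertex are Cauchy in `L^p`; hence a small translate of `F` into the tube is close to `F`
(`exists_shift_approx`). The translate is bounded, and dividing it by a power of a product of affine
functions close to 1 makes it decay at little cost (`exists_damp_approx`). -/

theorem mem_dualCone {t : EuclideanSpace ℝ (Fin n)} :
    t ∈ dualCone Γ ↔ ∀ y ∈ Γ, 0 ≤ inner ℝ y t := Iff.rfl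

theorem dualCone_add {s t : EuclideanSpace ℝ (Fin n)} (hs : s ∈ dualCone Γ)
    (ht : t ∈ dualCone Γ) : s + t ∈ dualCone Γ := fun y hy => by
  have h1 := mem_dualCone.1 hs y hy
  have h2 := mem_dualCone.1 ht y hy
  have : inner ℝ y (s + t) = inner ℝ y s + inner ℝ y t := inner_add_right _ _ _
  simpa [this] using add_nonneg h1 h2

theorem dualCone_smul {t : EuclideanSpace ℝ (Fin n)} {c : ℝ} (hc : 0 ≤ c)
    (ht : t ∈ dualCone Γ) : c • t ∈ dualCone Γ := mem_dualCone.2 fun y hy => by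
  rw [inner_smul_right]
  exact mul_nonneg hc (mem_dualCone.1 ht y hy)

theorem dualCone_sum {ι : Type*} (s : Finset ι) (t : ι → EuclideanSpace ℝ (Fin n))
    (ht : ∀ i ∈ s, t i ∈ dualCone Γ) : ∑ i ∈ s, t i ∈ dualCone Γ := mem_dualCone.2 fun y hy => by
  rw [inner_sum]
  exact Finset.sum_nonneg fun i hi => mem_dualCone.1 (ht i hi) y hy

theorem isClosed_dualCone : IsClosed (dualCone Γ) := by
  have : dualCone Γ = ⋂ y ∈ Γ, {t | 0 ≤ inner ℝ y t} := by
    ext t; simp [mem_dualCone]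
  rw [this]
  exact isClosed_biInter fun y _ => isClosed_le continuous_const (by fun_prop)

namespace IsOpenCone

theorem smul_mem (h : IsOpenCone Γ) {y : EuclideanSpace ℝ (Fin n)} (hy : y ∈ Γ) {c : ℝ}
    (hc : 0 < c) : c • y ∈ Γ := by
  have := h.add_mem y hy y hy (c / 2) (c / 2) (by positivity) (by positivity)
  rwa [← add_smul, add_halves] at this

theorem add_mem' (h : IsOpenCone Γ) {y z : EuclideanSpace ℝ (Fin n)} (hy : y ∈ Γ)
    (hz : z ∈ Γ) : y + z ∈ Γ := by
  simpa using h.add_mem y hy z hz 1 1 one_pos one_pos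

theorem convex (h : IsOpenCone Γ) : Convex ℝ Γ := by
  rw [convex_iff_forall_pos]
  intro x hx y hy a b ha hb _
  exact h.add_mem x hx y hy a b ha hb

/-- Points outside an open cone are separated from it by a nonzero vector of the dual cone. -/
theorem exists_dual_le_zero (h : IsOpenCone Γ) {β : EuclideanSpace ℝ (Fin n)} (hβ : β ∉ Γ) :
    ∃ t ∈ dualCone Γ, t ≠ 0 ∧ inner ℝ β t ≤ 0 := by
  obtain ⟨f, hf⟩ := geometric_hahn_banach_point_open h.convex h.isOpen hβ
  set t := (InnerProductSpace.toDual ℝ (EuclideanSpace ℝ (Fin n))).symm f with ht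
  have hft : ∀ y, f y = inner ℝ y t := fun y => by
    rw [real_inner_comm, ht, InnerProductSpace.toDual_symm_apply]
  refine ⟨t, mem_dualCone.2 fun y hy => ?_, ?_, ?_⟩
  · by_contra! hneg
    rw [← hft] at hneg
    -- The scale sends `f y < 0` to `-(1 + |f β|)`, which lies below `f β` and contradicts
    -- separation.
    have h1 := hf _ (h.smul_mem hy (c := (1 + |f β|) / (-f y))
      (div_pos (by positivity) (by linarith)))
    rw [map_smul, smul_eq_mul, div_mul_eq_mul_div, lt_div_iff₀ (by linarith)] at h1
    nlinarith [neg_abs_le (f β)]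
  · intro h0
    obtain ⟨y, hy⟩ := h.nonempty
    have := hf y hy
    rw [hft, hft, h0] at this
    simp at this
  · rw [← hft]
    obtain ⟨y, hy⟩ := h.nonempty
    -- Shrinking `y` to the vertex turns `f β < f (c • y)` into `f β ≤ 0`.
    have hlim : Tendsto (fun c : ℝ => c * f y) (𝓝[>] 0) (𝓝 (0 * f y)) :=
      (tendsto_nhdsWithin_of_tendsto_nhds tendsto_id).mul_const _
    rw [zero_mul] at hlim
    refine ge_of_tendsto hlim ?_
    filter_upwards [self_mem_nhdsWithin] with c hc
    have := hf _ (h.smul_mem hy hc)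
    rw [map_smul, smul_eq_mul] at this
    exact this.le

/-- A ball about `y` lies in the cone, so `y` can be moved a fixed distance in the direction `-t`
with its product with `t` still nonnegative. -/
theorem exists_mul_norm_le (h : IsOpenCone Γ) {y : EuclideanSpace ℝ (Fin n)} (hy : y ∈ Γ) :
    ∃ c > 0, ∀ t ∈ dualCone Γ, c * ‖t‖ ≤ inner ℝ y t := by
  obtain ⟨r, hr, hball⟩ := Metric.isOpen_iff.1 h.isOpen y hy
  refine ⟨r / 2, by positivity, fun t ht => ?_⟩
  rcases eq_or_ne t 0 with rfl | h0
  · simp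
  have hn : 0 < ‖t‖ := norm_pos_iff.2 h0
  have hmem : y - (r / 2 / ‖t‖) • t ∈ Γ := hball (by
    rw [Metric.mem_ball, dist_eq_norm, sub_sub_cancel_left, norm_neg, norm_smul, Real.norm_eq_abs,
      abs_of_pos (by positivity), div_mul_cancel₀ _ hn.ne']
    linarith)
  have := mem_dualCone.1 ht _ hmem
  rw [inner_sub_left, real_inner_smul_left, real_inner_self_eq_norm_sq] at this
  have e : r / 2 / ‖t‖ * ‖t‖ ^ 2 = r / 2 * ‖t‖ := by field_simp
  linarith

theorem inner_pos (h : IsOpenCone Γ) {y t : EuclideanSpace ℝ (Fin n)} (hy : y ∈ Γ)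
    (ht : t ∈ dualCone Γ) (h0 : t ≠ 0) : 0 < inner ℝ y t := by
  obtain ⟨c, hc, hle⟩ := h.exists_mul_norm_le hy
  exact (mul_pos hc (norm_pos_iff.2 h0)).trans_le (hle t ht)

/-- By separation, a point that is strictly positive on every nonzero dual vector belongs to the
cone. -/
theorem add_mem_of_abs_lt (h : IsOpenCone Γ) {y v : EuclideanSpace ℝ (Fin n)}
    (hv : ∀ t ∈ dualCone Γ, t ≠ 0 → |inner ℝ v t| < inner ℝ y t) : y + v ∈ Γ := by
  by_contra hn
  obtain ⟨t, ht, h0, hle⟩ := h.exists_dual_le_zero hn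
  rw [inner_add_left] at hle
  linarith [hv t ht h0, neg_abs_le (inner ℝ v t)]

end IsOpenCone

/-! ### Size of the kernel on the diagonal. -/

/-- The Cauchy–Szegő kernel on the diagonal, as a function of the imaginary part. -/
noncomputable def diagKernel (Γ : Set (EuclideanSpace ℝ (Fin n)))
    (y : EuclideanSpace ℝ (Fin n)) : ℝ :=
  ∫ t in dualCone Γ, Real.exp (-(4 * Real.pi) * inner ℝ y t)

theorem cauchySzego_diag (x y : EuclideanSpace ℝ (Fin n)) :
    cauchySzego Γ (cpoint x y) (cpoint x y) = diagKernel Γ y := by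
  rw [cauchySzego, diagKernel, ← integral_complex_ofReal]
  congr 1
  ext t
  rw [← Complex.exp_conj, ← Complex.exp_add, Complex.ofReal_exp]
  congr 1
  have e1 : ∑ j, (cpoint x y) j * (t j : ℂ) =
      ((inner ℝ x t : ℝ) : ℂ) + Complex.I * ((inner ℝ y t : ℝ) : ℂ) := by
    simp only [cpoint, PiLp.inner_apply, RCLike.inner_apply, conj_trivial, Complex.ofReal_sum,
      Complex.ofReal_mul, Finset.mul_sum, ← Finset.sum_add_distrib]
    exact Finset.sum_congr rfl fun j _ => by ring
  rw [e1]
  simp only [map_mul, map_add, Complex.conj_I, Complex.conj_ofReal, map_ofNat]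
  push_cast
  linear_combination (4 * Real.pi * inner ℝ y t : ℂ) * Complex.I_mul_I

theorem kernelRatio_eq (p : ℝ) (F : EuclideanSpace ℂ (Fin n) → ℂ)
    (x y : EuclideanSpace ℝ (Fin n)) :
    kernelRatio p Γ F (cpoint x y) = ‖F (cpoint x y)‖ / diagKernel Γ y ^ (1 / p) := by
  rw [kernelRatio, cauchySzego_diag, Complex.ofReal_re]

theorem integrable_exp_neg_mul_norm {E : Type*} [NormedAddCommGroup E] [NormedSpace ℝ E]
    [FiniteDimensional ℝ E] [MeasurableSpace E] [BorelSpace E] (μ : Measure E)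
    [μ.IsAddHaarMeasure] {c : ℝ} (hc : 0 < c) :
    Integrable (fun t : E => Real.exp (-c * ‖t‖)) μ := by
  set m := Module.finrank ℝ E + 1
  have h1 : Integrable (fun t : E => (1 + ‖t‖) ^ (-(m : ℝ))) μ :=
    integrable_one_add_norm (by simp [m])
  have hlim : Tendsto (fun s : ℝ => (1 + s) ^ m * Real.exp (-c * s)) atTop (𝓝 0) := by
    have h2 := (Real.tendsto_pow_mul_exp_neg_atTop_nhds_zero m).comp
      ((tendsto_atTop_add_const_left atTop (1 : ℝ) tendsto_id).const_mul_atTop hc)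
    have h3 := h2.const_mul ((1 / c) ^ m * Real.exp c)
    rw [mul_zero] at h3
    refine h3.congr fun s => ?_
    simp only [Function.comp, id]
    rw [mul_pow, show -(c * (1 + s)) = -c * s + -c by ring, Real.exp_add]
    have : Real.exp c * Real.exp (-c) = 1 := by rw [← Real.exp_add]; simp
    have h4 : (1 / c) ^ m * c ^ m = 1 := by rw [← mul_pow]; simp [hc.ne']
    linear_combination ((1 / c) ^ m * c ^ m * (1 + s) ^ m * Real.exp (-c * s)) * this +
      ((1 + s) ^ m * Real.exp (-c * s)) * h4
  obtain ⟨S, hS⟩ := eventually_atTop.1 (hlim.eventually (gt_mem_nhds one_pos))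
  have hcont : ContinuousOn (fun s : ℝ => (1 + s) ^ m * Real.exp (-c * s)) (Set.Icc 0 S) := by
    fun_prop
  obtain ⟨B, hB⟩ := isCompact_Icc.bddAbove_image hcont
  refine (h1.const_mul (max B 1)).mono' (by fun_prop) (ae_of_all _ fun t => ?_)
  rw [Real.norm_eq_abs, Real.abs_exp, Real.rpow_neg (by positivity), Real.rpow_natCast,
    ← div_eq_mul_inv, le_div_iff₀ (by positivity), mul_comm]
  rcases le_total ‖t‖ S with hle | hle
  · exact (hB ⟨‖t‖, ⟨norm_nonneg _, hle⟩, rfl⟩).trans (le_max_left _ _)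
  · exact (hS _ hle).le.trans (le_max_right _ _)

namespace IsOpenCone

theorem integrableOn_exp (h : IsOpenCone Γ) {y : EuclideanSpace ℝ (Fin n)} (hy : y ∈ Γ) :
    IntegrableOn (fun t => Real.exp (-(4 * Real.pi) * inner ℝ y t)) (dualCone Γ) := by
  obtain ⟨c, hc, hle⟩ := h.exists_mul_norm_le hy
  have hpi := Real.pi_pos
  refine ((integrable_exp_neg_mul_norm volume
    (show 0 < 4 * Real.pi * c by positivity)).integrableOn).mono' (by fun_prop) ?_
  filter_upwards [ae_restrict_mem isClosed_dualCone.measurableSet] with t ht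
  rw [Real.norm_eq_abs, Real.abs_exp, Real.exp_le_exp]
  have := mul_le_mul_of_nonneg_left (hle t ht) (show 0 ≤ 4 * Real.pi by positivity)
  linarith

theorem diagKernel_anti (h : IsOpenCone Γ) {y s : EuclideanSpace ℝ (Fin n)} (hy : y ∈ Γ)
    (hs : s ∈ Γ) : diagKernel Γ (y + s) ≤ diagKernel Γ y := by
  refine setIntegral_mono_on (h.integrableOn_exp (h.add_mem' hy hs)) (h.integrableOn_exp hy)
    isClosed_dualCone.measurableSet fun t ht => ?_
  rw [Real.exp_le_exp, inner_add_left]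
  have := mul_nonneg (show 0 ≤ 4 * Real.pi by positivity) (mem_dualCone.1 ht s hs)
  linarith

/-- The source of every lower bound for the kernel: each one amounts to a choice of a large `S`
inside the dual cone on which `y · t` stays bounded. -/
theorem exp_mul_volume_le_diagKernel (h : IsOpenCone Γ) {y : EuclideanSpace ℝ (Fin n)}
    (hy : y ∈ Γ) {S : Set (EuclideanSpace ℝ (Fin n))} (hS : MeasurableSet S)
    (hsub : S ⊆ dualCone Γ) (hfin : volume S ≠ ⊤) {B : ℝ} (hB : ∀ t ∈ S, inner ℝ y t ≤ B) :
    Real.exp (-(4 * Real.pi) * B) * volume.real S ≤ diagKernel Γ y := by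
  have h1 : ∫ _ in S, Real.exp (-(4 * Real.pi) * B) ≤
      ∫ t in S, Real.exp (-(4 * Real.pi) * inner ℝ y t) := by
    refine setIntegral_mono_on (integrableOn_const hfin)
      ((h.integrableOn_exp hy).mono_set hsub) hS fun t ht => ?_
    rw [Real.exp_le_exp]
    have := mul_le_mul_of_nonneg_left (hB t ht) (show 0 ≤ 4 * Real.pi by positivity)
    linarith
  have h2 : ∫ t in S, Real.exp (-(4 * Real.pi) * inner ℝ y t) ≤ diagKernel Γ y :=
    setIntegral_mono_set (h.integrableOn_exp hy) (ae_of_all _ fun t => (Real.exp_pos _).le)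
      (LE.le.eventuallyLE hsub)
  rw [setIntegral_const, smul_eq_mul, mul_comm] at h1
  exact h1.trans h2

end IsOpenCone

namespace IsRegularCone

theorem exists_ball_subset_dualCone (h : IsRegularCone Γ) :
    ∃ τ : EuclideanSpace ℝ (Fin n), ∃ r > 0, Metric.ball τ r ⊆ dualCone Γ := by
  obtain ⟨τ, hτ⟩ := h.interior_dual
  obtain ⟨r, hr, hsub⟩ := Metric.isOpen_iff.1 isOpen_interior τ hτ
  exact ⟨τ, r, hr, hsub.trans interior_subset⟩

/-- The diagonal kernel decays at most like `|y|⁻ⁿ`. -/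
theorem exists_le_diagKernel (h : IsRegularCone Γ) :
    ∃ c > 0, ∀ y ∈ Γ, c * ((1 + ‖y‖) ^ n)⁻¹ ≤ diagKernel Γ y := by
  obtain ⟨τ, r, hr, hsub⟩ := h.exists_ball_subset_dualCone
  refine ⟨Real.exp (-(4 * Real.pi) * (‖τ‖ + r)) * volume.real (Metric.ball τ r),
    mul_pos (Real.exp_pos _) (ENNReal.toReal_pos (Metric.measure_ball_pos volume _ hr).ne'
      measure_ball_lt_top.ne), fun y hy => ?_⟩
  have hpos : 0 < 1 + ‖y‖ := by positivity
  -- Shrinking a fixed ball of the dual cone by this factor keeps `y · t ≤ ‖τ‖ + r` on it and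
  -- multiplies its volume by `(1 + ‖y‖)⁻ⁿ`.
  set a := (1 + ‖y‖)⁻¹ with ha
  have ha0 : 0 < a := inv_pos.2 hpos
  have hvol : volume.real (a • Metric.ball τ r) = ((1 + ‖y‖) ^ n)⁻¹ *
      volume.real (Metric.ball τ r) := by
    rw [Measure.real, Measure.addHaar_smul, ENNReal.toReal_mul, finrank_euclideanSpace_fin,
      ENNReal.toReal_ofReal (abs_nonneg _), abs_of_pos (by positivity), ha, inv_pow]
    rfl
  have := h.exp_mul_volume_le_diagKernel hy (S := a • Metric.ball τ r) (B := ‖τ‖ + r)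
    (Metric.isOpen_ball.measurableSet.const_smul_of_ne_zero ha0.ne') ?_ ?_ ?_
  · rw [hvol] at this
    linarith
  · rintro _ ⟨t, ht, rfl⟩
    exact dualCone_smul ha0.le (hsub ht)
  · rw [Measure.addHaar_smul]
    exact ENNReal.mul_ne_top ENNReal.ofReal_ne_top measure_ball_lt_top.ne
  · rintro _ ⟨t, ht, rfl⟩
    simp only [inner_smul_right]
    have h1 : inner ℝ y t ≤ ‖y‖ * ‖t‖ := real_inner_le_norm _ _
    have h2 : ‖t‖ ≤ ‖τ‖ + r := by
      have := norm_le_norm_add_norm_sub' t τ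
      rw [Metric.mem_ball, dist_eq_norm] at ht
      linarith
    rw [ha, inv_mul_le_iff₀ hpos]
    nlinarith [norm_nonneg y, norm_nonneg t]

theorem diagKernel_pos (h : IsRegularCone Γ) {y : EuclideanSpace ℝ (Fin n)} (hy : y ∈ Γ) :
    0 < diagKernel Γ y := by
  obtain ⟨c, hc, hle⟩ := h.exists_le_diagKernel
  exact (by positivity : 0 < c * ((1 + ‖y‖) ^ n)⁻¹).trans_le (hle y hy)

/-- The diagonal kernel blows up at the boundary of the cone. -/
theorem tendsto_diagKernel_frontier (h : IsRegularCone Γ) {β : EuclideanSpace ℝ (Fin n)}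
    (hβ : β ∈ frontier Γ) : Tendsto (diagKernel Γ) (𝓝[Γ] β) atTop := by
  obtain ⟨τ, r, hr, hsub⟩ := h.exists_ball_subset_dualCone
  have hβn : β ∉ Γ := fun hm => by
    rw [h.isOpen.frontier_eq] at hβ
    exact hβ.2 hm
  -- Moving a ball of the dual cone along `t` does not increase its products with `β`. So
  -- arbitrarily many disjoint translates contribute equally to the kernel at points near `β`.
  obtain ⟨t, ht, ht0, hle⟩ := h.exists_dual_le_zero hβn
  have htn : 0 < ‖t‖ := norm_pos_iff.2 ht0
  set V := volume.real (Metric.ball τ r) with hV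
  have hVpos : 0 < V := ENNReal.toReal_pos (Metric.measure_ball_pos volume _ hr).ne'
    measure_ball_lt_top.ne
  -- The `1` absorbs the error of replacing `β` by a nearby `y`.
  set B := ‖β‖ * (‖τ‖ + r) + 1 with hB
  -- Consecutive centres are then `2 r` apart, so the open balls are disjoint.
  set c := 2 * r / ‖t‖ with hc
  have hc0 : 0 < c := by positivity
  rw [tendsto_atTop]
  intro A
  obtain ⟨m, hm⟩ := exists_nat_ge (A / (Real.exp (-(4 * Real.pi) * B) * V))
  rw [div_le_iff₀ (mul_pos (Real.exp_pos _) hVpos)] at hm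
  have hDpos : 0 < ‖τ‖ + r + m * (c * ‖t‖) := by positivity
  have hnear : ∀ᶠ y in 𝓝[Γ] β, ‖y - β‖ < 1 / (‖τ‖ + r + m * (c * ‖t‖)) := by
    refine eventually_nhdsWithin_of_eventually_nhds ?_
    have := Metric.ball_mem_nhds β (show 0 < 1 / (‖τ‖ + r + m * (c * ‖t‖)) by positivity)
    filter_upwards [this] with y hy
    rwa [Metric.mem_ball, dist_eq_norm] at hy
  filter_upwards [hnear, self_mem_nhdsWithin] with y hyβ hy
  set S := ⋃ k ∈ Finset.range m, Metric.ball (τ + ((k : ℝ) * c) • t) r with hS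
  have hSmem : ∀ s ∈ S, ∃ k < m, ∃ b ∈ Metric.ball τ r, s = b + ((k : ℝ) * c) • t := by
    intro s hs
    simp only [hS, Set.mem_iUnion, Finset.mem_range, exists_prop] at hs
    obtain ⟨k, hk, hs⟩ := hs
    refine ⟨k, hk, s - ((k : ℝ) * c) • t, ?_, by simp⟩
    rw [Metric.mem_ball, dist_eq_norm] at hs ⊢
    rwa [show s - ((k : ℝ) * c) • t - τ = s - (τ + ((k : ℝ) * c) • t) by abel]
  have hvol : volume S = m * volume (Metric.ball τ r) := by
    rw [hS, measure_biUnion_finset]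
    · simp [Measure.addHaar_ball_center volume (_ + _) r, Measure.addHaar_ball_center volume τ r]
    · intro i _ j _ hij
      refine Metric.ball_disjoint_ball ?_
      rw [dist_eq_norm, add_sub_add_left_eq_sub, ← sub_smul, ← sub_mul, norm_smul, norm_mul,
        Real.norm_eq_abs, Real.norm_eq_abs, abs_of_pos hc0, hc, mul_assoc,
        div_mul_cancel₀ _ htn.ne']
      have : (1 : ℝ) ≤ |(i : ℝ) - j| := by
        have h1 : (1 : ℤ) ≤ |(i : ℤ) - j| := Int.one_le_abs (sub_ne_zero.2 (by exact_mod_cast hij))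
        exact_mod_cast h1
      nlinarith
    · exact fun _ _ => Metric.isOpen_ball.measurableSet
  have hkey := h.exp_mul_volume_le_diagKernel hy (S := S) (B := B)
    (Finset.measurableSet_biUnion _ fun _ _ => Metric.isOpen_ball.measurableSet) ?_ ?_ ?_
  · refine hm.trans (le_trans (le_of_eq ?_) hkey)
    rw [Measure.real, hvol, ENNReal.toReal_mul, ENNReal.toReal_natCast, hV, Measure.real]
    ring
  · intro s hs
    obtain ⟨k, -, b, hb, rfl⟩ := hSmem s hs
    exact dualCone_add (hsub hb) (dualCone_smul (by positivity) ht)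
  · rw [hvol]
    exact ENNReal.mul_ne_top (ENNReal.natCast_ne_top m) measure_ball_lt_top.ne
  · intro s hs
    obtain ⟨k, hk, b, hb, rfl⟩ := hSmem s hs
    have hbn : ‖b‖ ≤ ‖τ‖ + r := by
      have := norm_le_norm_add_norm_sub' b τ
      rw [Metric.mem_ball, dist_eq_norm] at hb
      linarith
    have e : inner ℝ y (b + ((k : ℝ) * c) • t) = inner ℝ β b + (k * c) * inner ℝ β t +
        inner ℝ (y - β) (b + ((k : ℝ) * c) • t) := by
      rw [inner_sub_left, inner_add_right, inner_add_right, inner_smul_right, inner_smul_right]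
      ring
    have h1 : inner ℝ β b ≤ ‖β‖ * (‖τ‖ + r) :=
      (real_inner_le_norm _ _).trans (mul_le_mul_of_nonneg_left hbn (norm_nonneg _))
    have h2 : (k * c) * inner ℝ β t ≤ 0 := mul_nonpos_of_nonneg_of_nonpos (by positivity) hle
    have h3 : ‖b + ((k : ℝ) * c) • t‖ ≤ ‖τ‖ + r + m * (c * ‖t‖) := by
      refine (norm_add_le _ _).trans (add_le_add hbn ?_)
      rw [norm_smul, Real.norm_eq_abs, abs_of_nonneg (by positivity), mul_assoc]
      have : (k : ℝ) ≤ m := by exact_mod_cast hk.le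
      gcongr
    have h4 : inner ℝ (y - β) (b + ((k : ℝ) * c) • t) ≤ 1 := by
      refine (real_inner_le_norm _ _).trans ?_
      rw [lt_div_iff₀ hDpos] at hyβ
      refine (mul_le_mul_of_nonneg_left h3 (norm_nonneg _)).trans hyβ.le
    rw [e]
    linarith

end IsRegularCone

/-! ### Determinants and Auerbach bases in slices of the dual cone. -/

/-- The matrix whose rows are the given vectors. -/
def rowMatrix (t : Fin n → EuclideanSpace ℝ (Fin n)) : Matrix (Fin n) (Fin n) ℝ :=
  Matrix.of fun i j => t i j

/-- The linear endomorphism `u ↦ (t i · u)_i` of Euclidean space. -/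
noncomputable def rowMap (t : Fin n → EuclideanSpace ℝ (Fin n)) :
    EuclideanSpace ℝ (Fin n) →ₗ[ℝ] EuclideanSpace ℝ (Fin n) :=
  Matrix.toLin (EuclideanSpace.basisFun (Fin n) ℝ).toBasis
    (EuclideanSpace.basisFun (Fin n) ℝ).toBasis (rowMatrix t)

theorem rowMap_apply (t : Fin n → EuclideanSpace ℝ (Fin n)) (u : EuclideanSpace ℝ (Fin n))
    (i : Fin n) : rowMap t u i = inner ℝ u (t i) := by
  simp only [rowMap, Matrix.toLin_apply, Matrix.mulVec, dotProduct, PiLp.inner_apply,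
    OrthonormalBasis.coe_toBasis, OrthonormalBasis.coe_toBasis_repr_apply,
    EuclideanSpace.basisFun_repr, EuclideanSpace.basisFun_apply]
  simp [rowMatrix, Finset.sum_apply, Pi.single_apply]

theorem det_rowMap (t : Fin n → EuclideanSpace ℝ (Fin n)) :
    LinearMap.det (rowMap t) = (rowMatrix t).det :=
  LinearMap.det_toLin _ _

/-- The linear endomorphism `a ↦ ∑ i, a i • t i` of Euclidean space. -/
noncomputable def colMap (t : Fin n → EuclideanSpace ℝ (Fin n)) :
    EuclideanSpace ℝ (Fin n) →ₗ[ℝ] EuclideanSpace ℝ (Fin n) :=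
  Matrix.toLin (EuclideanSpace.basisFun (Fin n) ℝ).toBasis
    (EuclideanSpace.basisFun (Fin n) ℝ).toBasis (rowMatrix t).transpose

theorem colMap_apply (t : Fin n → EuclideanSpace ℝ (Fin n)) (a : EuclideanSpace ℝ (Fin n)) :
    colMap t a = ∑ i, a i • t i := by
  ext j
  simp only [colMap, Matrix.toLin_apply, Matrix.mulVec, dotProduct,
    OrthonormalBasis.coe_toBasis, OrthonormalBasis.coe_toBasis_repr_apply,
    EuclideanSpace.basisFun_repr, EuclideanSpace.basisFun_apply]
  simp [rowMatrix, Finset.sum_apply, Pi.single_apply, mul_comm]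

theorem det_colMap (t : Fin n → EuclideanSpace ℝ (Fin n)) :
    LinearMap.det (colMap t) = (rowMatrix t).det := by
  rw [colMap, LinearMap.det_toLin, Matrix.det_transpose]

theorem continuous_det_rowMatrix :
    Continuous fun t : Fin n → EuclideanSpace ℝ (Fin n) => (rowMatrix t).det := by
  refine Continuous.matrix_det (continuous_matrix fun i j => ?_)
  simp only [rowMatrix, Matrix.of_apply]
  fun_prop

/-- Cramer's rule for the rows of a matrix. -/
theorem det_smul_eq_sum (t : Fin n → EuclideanSpace ℝ (Fin n)) (s : EuclideanSpace ℝ (Fin n)) :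
    (rowMatrix t).det • s = ∑ i, (rowMatrix (Function.update t i s)).det • t i := by
  have h := Matrix.mulVec_cramer (rowMatrix t).transpose s
  have e : ∀ i, (rowMatrix t).transpose.cramer s i = (rowMatrix (Function.update t i s)).det := by
    intro i
    rw [Matrix.cramer_transpose_apply]
    congr 1
    ext a b
    rcases eq_or_ne a i with rfl | hne
    · simp [rowMatrix]
    · simp [rowMatrix, Matrix.updateRow_ne hne, Function.update_of_ne hne]
  ext j
  have hj := congrFun h j
  rw [Matrix.det_transpose] at hj
  simp only [PiLp.smul_apply, Pi.smul_apply, smul_eq_mul, WithLp.ofLp_sum, WithLp.ofLp_smul,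
    Finset.sum_apply] at hj ⊢
  rw [← hj]
  simp only [Matrix.mulVec, dotProduct, e, Matrix.transpose_apply]
  exact Finset.sum_congr rfl fun i _ => by simp [rowMatrix, mul_comm]

/-- The slice `{t ∈ Γ* | y · t = 1}` of the dual cone. -/
def dualSlice (Γ : Set (EuclideanSpace ℝ (Fin n))) (y : EuclideanSpace ℝ (Fin n)) :
    Set (EuclideanSpace ℝ (Fin n)) := dualCone Γ ∩ {t | inner ℝ y t = 1}

theorem IsOpenCone.isCompact_dualSlice (h : IsOpenCone Γ) {y : EuclideanSpace ℝ (Fin n)}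
    (hy : y ∈ Γ) : IsCompact (dualSlice Γ y) := by
  obtain ⟨c, hc, hle⟩ := h.exists_mul_norm_le hy
  refine Metric.isCompact_of_isClosed_isBounded
    (isClosed_dualCone.inter (isClosed_eq (by fun_prop) continuous_const)) ?_
  refine Metric.isBounded_closedBall.subset (t := Metric.closedBall 0 (1 / c)) fun t ht => ?_
  rw [mem_closedBall_zero_iff, le_div_iff₀ hc, mul_comm]
  exact (hle t ht.1).trans_eq ht.2

/-- The dual cone has interior points, hence contains a basis; each basis vector is positive on `y`
and can be rescaled into the slice. -/
theorem IsRegularCone.exists_dualSlice_det_ne_zero (h : IsRegularCone Γ)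
    {y : EuclideanSpace ℝ (Fin n)} (hy : y ∈ Γ) :
    ∃ t : Fin n → EuclideanSpace ℝ (Fin n), (∀ i, t i ∈ dualSlice Γ y) ∧
      (rowMatrix t).det ≠ 0 := by
  have hspan : Submodule.span ℝ (dualCone Γ) = ⊤ :=
    Submodule.eq_top_of_nonempty_interior' _
      (h.interior_dual.mono (interior_mono Submodule.subset_span))
  have key : ∃ t : Fin n → EuclideanSpace ℝ (Fin n), (∀ i, t i ∈ dualCone Γ) ∧
      LinearIndependent ℝ t := by
    obtain ⟨t, ht, -, hli⟩ := Submodule.exists_fun_fin_finrank_span_eq ℝ (dualCone Γ)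
    have hn : Module.finrank ℝ (Submodule.span ℝ (dualCone Γ)) = n := by
      rw [hspan, finrank_top, finrank_euclideanSpace_fin]
    exact ⟨t ∘ Fin.cast hn.symm, fun i => ht _, hli.comp _ (Fin.cast_injective _)⟩
  obtain ⟨t, ht, hli⟩ := key
  have hpos : ∀ i, 0 < inner ℝ y (t i) := fun i => h.inner_pos hy (ht i) (hli.ne_zero i)
  set w : Fin n → ℝˣ := fun i => (Units.mk0 _ (hpos i).ne')⁻¹ with hw
  have hli' := hli.units_smul w
  refine ⟨w • t, fun i => ⟨dualCone_smul ?_ (ht i), ?_⟩, ?_⟩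
  · simp [hw, (hpos i).le]
  · have : (w • t) i = (inner ℝ y (t i))⁻¹ • t i := by
      simp [hw, Units.smul_def]
    rw [Set.mem_ofPred_eq, this, inner_smul_right, inv_mul_cancel₀ (hpos i).ne']
  · intro hdet
    have hrows : LinearIndependent ℝ (rowMatrix (w • t)).row := by
      have := hli'.map' (WithLp.linearEquiv 2 ℝ (Fin n → ℝ)).toLinearMap
        (LinearEquiv.ker _)
      exact this
    rw [Matrix.linearIndependent_rows_iff_isUnit, Matrix.isUnit_iff_isUnit_det, hdet] at hrows
    exact not_isUnit_zero hrows

/-- An Auerbach system in a slice of the dual cone. -/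
theorem IsRegularCone.exists_auerbach (h : IsRegularCone Γ) {y : EuclideanSpace ℝ (Fin n)}
    (hy : y ∈ Γ) :
    ∃ t : Fin n → EuclideanSpace ℝ (Fin n), (∀ i, t i ∈ dualSlice Γ y) ∧
      (rowMatrix t).det ≠ 0 ∧
      ∀ s ∈ dualSlice Γ y, ∃ c : Fin n → ℝ, (∀ i, |c i| ≤ 1) ∧ s = ∑ i, c i • t i := by
  obtain ⟨t₀, ht₀, hdet₀⟩ := h.exists_dualSlice_det_ne_zero hy
  -- Take a system maximizing `|det|`. By Cramer's rule the coefficients of `s` are ratios of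
  -- determinants with one row replaced by `s`, so maximality bounds them by 1.
  obtain ⟨t, ht, hmax⟩ := (isCompact_univ_pi (s := fun _ : Fin n => dualSlice Γ y)
    fun _ => h.isCompact_dualSlice hy).exists_isMaxOn ⟨t₀, fun i _ => ht₀ i⟩
    (continuous_det_rowMatrix.abs.continuousOn)
  have hpos : 0 < |(rowMatrix t).det| :=
    (abs_pos.2 hdet₀).trans_le (hmax (fun i _ => ht₀ i))
  refine ⟨t, fun i => ht i trivial, abs_pos.1 hpos, fun s hs =>
    ⟨fun i => (rowMatrix (Function.update t i s)).det / (rowMatrix t).det, fun i => ?_, ?_⟩⟩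
  · rw [abs_div, div_le_one hpos]
    refine hmax fun j _ => ?_
    rcases eq_or_ne j i with rfl | hne
    · simpa using hs
    · simpa [Function.update_of_ne hne] using ht j trivial
  · have := congrArg (fun v => (rowMatrix t).det⁻¹ • v) (det_smul_eq_sum t s)
    simp only [smul_smul, inv_mul_cancel₀ (abs_pos.1 hpos), one_smul, Finset.smul_sum] at this
    simpa only [div_eq_inv_mul] using this

/-! ### Parallelepipeds inside the cone, and their volume against the kernel. -/

theorem norm_le_sum_abs (u : EuclideanSpace ℝ (Fin n)) : ‖u‖ ≤ ∑ i, |u i| := by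
  have := norm_sum_le Finset.univ fun i =>
    (EuclideanSpace.basisFun (Fin n) ℝ).repr u i • EuclideanSpace.basisFun (Fin n) ℝ i
  rw [(EuclideanSpace.basisFun (Fin n) ℝ).sum_repr u] at this
  simpa [norm_smul] using this

/-- The cube of points all of whose coordinates are less than `r` in absolute value. -/
def cube (n : ℕ) (r : ℝ) : Set (EuclideanSpace ℝ (Fin n)) := {u | ∀ i, |u i| < r}

theorem isOpen_cube (r : ℝ) : IsOpen (cube n r) := by
  have : cube n r = ⋂ i, {u | |u i| < r} := by ext; simp [cube]
  rw [this]
  exact isOpen_iInter_of_finite fun i => isOpen_lt (by fun_prop) continuous_const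

theorem volume_cube_ne_zero {r : ℝ} (hr : 0 < r) : volume (cube n r) ≠ 0 :=
  ((isOpen_cube r).measure_pos volume ⟨0, fun i => by simpa using hr⟩).ne'

theorem volume_cube_ne_top (r : ℝ) : volume (cube n r) ≠ ⊤ := by
  refine (measure_mono (t := Metric.ball 0 (r * n + 1)) fun u hu => ?_).trans_lt
    measure_ball_lt_top |>.ne
  rw [mem_ball_zero_iff]
  have h1 := norm_le_sum_abs u
  have h2 : ∑ i, |u i| ≤ ∑ _i : Fin n, r := Finset.sum_le_sum fun i _ => (hu i).le
  rw [Finset.sum_const, Finset.card_univ, Fintype.card_fin, nsmul_eq_mul] at h2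
  linarith

/-- The parallelepiped `{u | ∀ i, |u · t i| < r}`. -/
def slab (t : Fin n → EuclideanSpace ℝ (Fin n)) (r : ℝ) : Set (EuclideanSpace ℝ (Fin n)) :=
  {u | ∀ i, |inner ℝ u (t i)| < r}

theorem volume_slab {t : Fin n → EuclideanSpace ℝ (Fin n)} (ht : (rowMatrix t).det ≠ 0)
    (r : ℝ) : volume (slab t r) = ENNReal.ofReal |(rowMatrix t).det|⁻¹ * volume (cube n r) := by
  have : slab t r = rowMap t ⁻¹' cube n r := by
    ext u
    simp [slab, cube, rowMap_apply]
  rw [this, Measure.addHaar_preimage_linearMap _ (by rwa [det_rowMap]), det_rowMap, abs_inv]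

/-- After normalizing a dual vector to `y · s = 1`, its coefficients are at most 1, so `|u · s| ≤ n
/ (n + 1) < 1 = y · s`. The denominator `n + 1` gives strictness and also covers `n = 0`. -/
theorem IsRegularCone.add_mem_of_mem_slab (h : IsRegularCone Γ) {y : EuclideanSpace ℝ (Fin n)}
    (hy : y ∈ Γ) {t : Fin n → EuclideanSpace ℝ (Fin n)}
    (ht : ∀ s ∈ dualSlice Γ y, ∃ c : Fin n → ℝ, (∀ i, |c i| ≤ 1) ∧ s = ∑ i, c i • t i)
    {u : EuclideanSpace ℝ (Fin n)} (hu : u ∈ slab t ((n : ℝ) + 1)⁻¹) : y + u ∈ Γ := by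
  refine h.add_mem_of_abs_lt fun s hs hs0 => ?_
  have hpos := h.inner_pos hy hs hs0
  obtain ⟨c, hc, hsum⟩ := ht ((inner ℝ y s)⁻¹ • s) ⟨dualCone_smul (by positivity) hs, by
    rw [Set.mem_ofPred_eq, inner_smul_right, inv_mul_cancel₀ hpos.ne']⟩
  have h1 : |inner ℝ u ((inner ℝ y s)⁻¹ • s)| < 1 := by
    rw [hsum, inner_sum]
    have hn : (0 : ℝ) < n + 1 := by positivity
    calc |∑ i, inner ℝ u (c i • t i)| ≤ ∑ i, |inner ℝ u (c i • t i)| :=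
          Finset.abs_sum_le_sum_abs _ _
      _ ≤ ∑ _i : Fin n, ((n : ℝ) + 1)⁻¹ := Finset.sum_le_sum fun i _ => by
          rw [inner_smul_right, abs_mul]
          have := mul_le_mul (hc i) (hu i).le (abs_nonneg _) zero_le_one
          linarith
      _ = n * ((n : ℝ) + 1)⁻¹ := by simp
      _ < 1 := by rw [← div_eq_mul_inv, div_lt_one hn]; linarith
  rw [inner_smul_right, abs_mul, abs_inv, abs_of_pos hpos, inv_mul_lt_iff₀ hpos, mul_one] at h1
  exact h1

/-- The combinations `∑ aᵢ tᵢ` with `a` in a fixed compact subset of the positive orthant lie in the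
dual cone, satisfy `y · t = ∑ aᵢ ≤ 2n`, and fill a volume proportional to `|det|`. The constant
depends on `n` alone. -/
theorem exists_det_le_diagKernel (n : ℕ) : ∃ C : ℝ, 0 ≤ C ∧
    ∀ {Γ : Set (EuclideanSpace ℝ (Fin n))}, IsRegularCone Γ → ∀ {y}, y ∈ Γ →
    ∀ t : Fin n → EuclideanSpace ℝ (Fin n), (∀ i, t i ∈ dualSlice Γ y) →
      |(rowMatrix t).det| ≤ C * diagKernel Γ y := by
  have hQK : ∃ Q : Set (EuclideanSpace ℝ (Fin n)), IsCompact Q ∧ 0 < volume.real Q ∧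
      ∀ a ∈ Q, ∀ i, 0 ≤ a i ∧ a i ≤ 2 := by
    refine ⟨Metric.closedBall (WithLp.toLp 2 fun _ => (1 : ℝ)) 1, isCompact_closedBall _ _,
      ENNReal.toReal_pos (Metric.measure_closedBall_pos volume _ one_pos).ne'
        measure_closedBall_lt_top.ne, fun a ha i => ?_⟩
    have h1 := (PiLp.norm_apply_le (a - WithLp.toLp 2 fun _ => (1 : ℝ)) i).trans
      (by simpa [dist_eq_norm] using ha)
    rw [PiLp.sub_apply, Real.norm_eq_abs, abs_le] at h1
    constructor <;> linarith [h1.1, h1.2]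
  obtain ⟨Q, hQ, hQpos, hQb⟩ := hQK
  refine ⟨Real.exp (4 * Real.pi * (2 * n)) / volume.real Q, by positivity,
    fun {Γ} h {y} hy t ht => ?_⟩
  have hvol : volume (colMap t '' Q) = ENNReal.ofReal |(rowMatrix t).det| * volume Q := by
    rw [Measure.addHaar_image_linearMap, det_colMap]
  have hcomp : IsCompact (colMap t '' Q) := hQ.image (colMap t).continuous_of_finiteDimensional
  have := h.exp_mul_volume_le_diagKernel hy (S := colMap t '' Q) (B := 2 * n)
    hcomp.measurableSet ?_ hcomp.measure_ne_top ?_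
  · rw [Measure.real, hvol, ENNReal.toReal_mul, ENNReal.toReal_ofReal (abs_nonneg _)] at this
    change _ * (_ * volume.real Q) ≤ _ at this
    rw [div_mul_eq_mul_div, le_div_iff₀ hQpos]
    have h2 := mul_le_mul_of_nonneg_left this (Real.exp_pos (4 * Real.pi * (2 * n))).le
    rwa [← mul_assoc, ← Real.exp_add, neg_mul, add_neg_cancel, Real.exp_zero, one_mul] at h2
  · rintro _ ⟨a, ha, rfl⟩
    rw [colMap_apply]
    exact dualCone_sum _ _ fun i _ => dualCone_smul (hQb a ha i).1 (ht i).1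
  · rintro _ ⟨a, ha, rfl⟩
    rw [colMap_apply, inner_sum]
    calc ∑ i, inner ℝ y (a i • t i) ≤ ∑ _i : Fin n, (2 : ℝ) := Finset.sum_le_sum fun i _ => by
          rw [inner_smul_right, show inner ℝ y (t i) = 1 from (ht i).2, mul_one]
          exact (hQb a ha i).2
      _ = 2 * n := by simp [mul_comm]

variable {F : EuclideanSpace ℂ (Fin n) → ℂ} {p : ℝ}

/-! ### The tube, and multiplication by complex scalars in real coordinates. -/

section Tube

theorem cpoint_mem_tube {x y : EuclideanSpace ℝ (Fin n)} : cpoint x y ∈ tube Γ ↔ y ∈ Γ := by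
  refine ⟨fun ⟨x', y', hy', h⟩ => ?_, fun h => ⟨x, y, h, rfl⟩⟩
  have : y = y' := by
    ext j
    have := congrArg (fun z : EuclideanSpace ℂ (Fin n) => (z j).im) h
    simpa [cpoint] using this
  rwa [this]

theorem continuous_cpoint :
    Continuous fun w : EuclideanSpace ℝ (Fin n) × EuclideanSpace ℝ (Fin n) =>
      cpoint w.1 w.2 := by
  refine (PiLp.continuous_toLp 2 _).comp (continuous_pi fun j => ?_)
  fun_prop

theorem measurable_cpoint :
    Measurable fun w : EuclideanSpace ℝ (Fin n) × EuclideanSpace ℝ (Fin n) =>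
      cpoint w.1 w.2 := continuous_cpoint.measurable

theorem isOpen_tube (h : IsOpen Γ) : IsOpen (tube Γ) := by
  have : tube Γ = (fun z : EuclideanSpace ℂ (Fin n) =>
      (WithLp.toLp 2 fun j => (z j).im : EuclideanSpace ℝ (Fin n))) ⁻¹' Γ := by
    ext z
    have hz : z = cpoint (WithLp.toLp 2 fun j => (z j).re) (WithLp.toLp 2 fun j => (z j).im) := by
      ext j
      apply Complex.ext <;> simp [cpoint]
    rw [Set.mem_preimage]
    conv_lhs => rw [hz]
    exact cpoint_mem_tube
  rw [this]
  refine h.preimage ((PiLp.continuous_toLp 2 _).comp (continuous_pi fun j => ?_))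
  exact Complex.continuous_im.comp (by fun_prop)

/-- Multiplication by a complex number, on pairs of real and imaginary parts. -/
noncomputable def complexMul (n : ℕ) (ζ : ℂ) :
    EuclideanSpace ℝ (Fin n) × EuclideanSpace ℝ (Fin n) →ₗ[ℝ]
      EuclideanSpace ℝ (Fin n) × EuclideanSpace ℝ (Fin n) :=
  LinearMap.prod (ζ.re • LinearMap.fst ℝ _ _ - ζ.im • LinearMap.snd ℝ _ _)
    (ζ.re • LinearMap.snd ℝ _ _ + ζ.im • LinearMap.fst ℝ _ _)

theorem complexMul_apply (ζ : ℂ) (w : EuclideanSpace ℝ (Fin n) × EuclideanSpace ℝ (Fin n)) :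
    complexMul n ζ w = (ζ.re • w.1 - ζ.im • w.2, ζ.re • w.2 + ζ.im • w.1) := rfl

theorem cpoint_add_smul (ζ : ℂ) (x y : EuclideanSpace ℝ (Fin n))
    (w : EuclideanSpace ℝ (Fin n) × EuclideanSpace ℝ (Fin n)) :
    cpoint x y + ζ • cpoint w.1 w.2 =
      cpoint (x + (complexMul n ζ w).1) (y + (complexMul n ζ w).2) := by
  ext j
  apply Complex.ext <;> simp [cpoint, complexMul_apply]

theorem measurePreserving_complexMul {ζ : ℂ} (hζ : ‖ζ‖ = 1) :
    MeasurePreserving (complexMul n ζ) := by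
  have h1 : Complex.normSq ζ = 1 := by rw [Complex.normSq_eq_norm_sq, hζ, one_pow]
  rw [Complex.normSq_apply] at h1
  -- `J` is complex conjugation. For `|ζ| = 1` both `J` and `w ↦ ζ w̄` are involutions, which forces
  -- the determinant of multiplication by `ζ` to be `±1`.
  set J : EuclideanSpace ℝ (Fin n) × EuclideanSpace ℝ (Fin n) →ₗ[ℝ]
      EuclideanSpace ℝ (Fin n) × EuclideanSpace ℝ (Fin n) :=
    (LinearMap.fst ℝ _ _).prod (-LinearMap.snd ℝ _ _) with hJ
  have hJJ : J ∘ₗ J = LinearMap.id := by ext w <;> simp [hJ]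
  have hcomp : (complexMul n ζ ∘ₗ J) ∘ₗ (complexMul n ζ ∘ₗ J) = LinearMap.id := by
    refine LinearMap.ext fun w => Prod.ext ?_ ?_
    · ext j
      simp [hJ, complexMul_apply]
      linear_combination w.1 j * h1
    · ext j
      simp [hJ, complexMul_apply]
      linear_combination w.2 j * h1
  have d1 := congrArg LinearMap.det hJJ
  have d2 := congrArg LinearMap.det hcomp
  simp only [LinearMap.det_comp, LinearMap.det_id] at d1 d2
  have d3 : LinearMap.det (complexMul n ζ) * LinearMap.det (complexMul n ζ) = 1 := by
    linear_combination d2 - (LinearMap.det (complexMul n ζ)) ^ 2 * d1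
  have habs : |LinearMap.det (complexMul n ζ)| = 1 := by
    rcases mul_self_eq_one_iff.1 d3 with h | h <;> simp [h]
  have hne : LinearMap.det (complexMul n ζ) ≠ 0 := fun h0 => by simp [h0] at habs
  refine ⟨(complexMul n ζ).continuous_of_finiteDimensional.measurable, ?_⟩
  have : (volume : Measure (EuclideanSpace ℝ (Fin n) × EuclideanSpace ℝ (Fin n))).IsAddHaarMeasure :=
    inferInstanceAs (Measure.prod volume volume).IsAddHaarMeasure
  rw [Measure.map_linearMap_addHaar_eq_smul_addHaar _ hne, abs_inv, habs]
  simp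

end Tube

/-! ### Mean value inequalities and the pointwise bound by the kernel. -/

section MeanValue

/-- The normalized arc length measure on `(0, 2π]`. -/
noncomputable def circleProb : Measure ℝ :=
  ENNReal.ofReal (2 * Real.pi)⁻¹ • volume.restrict (Set.Ioc 0 (2 * Real.pi))

instance : IsProbabilityMeasure circleProb := ⟨by
  rw [circleProb, Measure.smul_apply, Measure.restrict_apply_univ, Real.volume_Ioc, sub_zero,
    smul_eq_mul, ← ENNReal.ofReal_mul (by positivity), inv_mul_cancel₀ (by positivity),
    ENNReal.ofReal_one]⟩

theorem circleAverage_eq_integral (f : ℂ → ℂ) (c : ℂ) (R : ℝ) :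
    Real.circleAverage f c R = ∫ θ, f (circleMap c R θ) ∂circleProb := by
  rw [Real.circleAverage_def, circleProb, integral_smul_measure,
    intervalIntegral.integral_of_le (by positivity), ENNReal.toReal_ofReal (by positivity)]

theorem rpow_enorm_integral_le {α : Type*} [MeasurableSpace α] (μ : Measure α)
    [IsProbabilityMeasure μ] {p : ℝ} (hp : 1 ≤ p) {g : α → ℂ} (hg : AEStronglyMeasurable g μ) :
    ‖∫ a, g a ∂μ‖ₑ ^ p ≤ ∫⁻ a, ‖g a‖ₑ ^ p ∂μ := by
  have h0 : 0 < p := by linarith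
  have h1 := eLpNorm'_le_eLpNorm'_of_exponent_le one_pos hp μ hg
  simp only [eLpNorm', ENNReal.rpow_one, div_one] at h1
  calc ‖∫ a, g a ∂μ‖ₑ ^ p ≤ (∫⁻ a, ‖g a‖ₑ ∂μ) ^ p :=
        ENNReal.rpow_le_rpow (enorm_integral_le_lintegral_enorm _) h0.le
    _ ≤ ((∫⁻ a, ‖g a‖ₑ ^ p ∂μ) ^ (1 / p)) ^ p := ENNReal.rpow_le_rpow h1 h0.le
    _ = _ := by rw [← ENNReal.rpow_mul, one_div_mul_cancel h0.ne', ENNReal.rpow_one]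

/-- Mean value inequality for a bounded holomorphic function on the unit disc with radial limits
almost everywhere. -/
theorem enorm_rpow_le_lintegral_circle {p : ℝ} (hp : 1 ≤ p) {f : ℂ → ℂ} {g : ℝ → ℂ} {B : ℝ}
    (hf : DifferentiableOn ℂ f (Metric.ball 0 1)) (hB : ∀ w ∈ Metric.ball (0 : ℂ) 1, ‖f w‖ ≤ B)
    (hg : ∀ᵐ θ ∂circleProb,
      Tendsto (fun r : ℝ => f (circleMap 0 r θ)) (𝓝[<] 1) (𝓝 (g θ))) :
    ‖f 0‖ₑ ^ p ≤ ∫⁻ θ, ‖g θ‖ₑ ^ p ∂circleProb := by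
  have hIoo : Set.Ioo (0 : ℝ) 1 ∈ 𝓝[<] (1 : ℝ) := Ioo_mem_nhdsLT one_pos
  have hmem : ∀ r ∈ Set.Ioo (0 : ℝ) 1, ∀ θ, circleMap 0 r θ ∈ Metric.ball (0 : ℂ) 1 := by
    intro r hr θ
    rw [mem_ball_zero_iff, norm_circleMap_zero, abs_of_pos hr.1]
    exact hr.2
  have hmeas : ∀ᶠ r in 𝓝[<] (1 : ℝ),
      AEStronglyMeasurable (fun θ => f (circleMap 0 r θ)) circleProb := by
    filter_upwards [hIoo] with r hr
    exact (hf.continuousOn.comp_continuous (continuous_circleMap 0 r)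
      (hmem r hr)).aestronglyMeasurable
  have hlim : Tendsto (fun r : ℝ => ∫ θ, f (circleMap 0 r θ) ∂circleProb) (𝓝[<] 1)
      (𝓝 (∫ θ, g θ ∂circleProb)) := by
    refine tendsto_integral_filter_of_dominated_convergence (fun _ => B) hmeas ?_
      (integrable_const _) hg
    filter_upwards [hIoo] with r hr
    exact ae_of_all _ fun θ => hB _ (hmem r hr θ)
  have hconst : ∀ᶠ r in 𝓝[<] (1 : ℝ), ∫ θ, f (circleMap 0 r θ) ∂circleProb = f 0 := by
    filter_upwards [hIoo] with r hr
    rw [← circleAverage_eq_integral]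
    refine DiffContOnCl.circleAverage (DifferentiableOn.diffContOnCl (hf.mono ?_))
    rw [abs_of_pos hr.1]
    exact Metric.closure_ball_subset_closedBall.trans (Metric.closedBall_subset_ball hr.2)
  have heq : f 0 = ∫ θ, g θ ∂circleProb :=
    tendsto_nhds_unique (tendsto_const_nhds.congr' (hconst.mono fun _ h => h.symm)) hlim
  -- Measurability of `g` comes from its being an almost everywhere limit along a sequence of radii;
  -- the shift by `N` keeps only radii whose circle functions are measurable.
  have hgm : AEStronglyMeasurable g circleProb := by
    obtain ⟨u, hu⟩ := exists_seq_tendsto (𝓝[<] (1 : ℝ))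
    obtain ⟨N, hN⟩ := eventually_atTop.1 (hu.eventually hmeas)
    refine aestronglyMeasurable_of_tendsto_ae atTop (f := fun k θ => f (circleMap 0 (u (k + N)) θ))
      (fun k => hN _ (by omega)) ?_
    filter_upwards [hg] with θ hθ
    exact hθ.comp (hu.comp (tendsto_add_atTop_nat N))
  rw [heq]
  exact rpow_enorm_integral_le _ hp hgm

/-- Mean value inequality over a circled set of displacements. -/
theorem volume_mul_enorm_rpow_le (hp : 1 ≤ p) (hΓ : IsOpen Γ) (hm : Measurable F)
    (hF : DifferentiableOn ℂ F (tube Γ)) {x y : EuclideanSpace ℝ (Fin n)}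
    {D : Set (EuclideanSpace ℝ (Fin n) × EuclideanSpace ℝ (Fin n))} (hD : MeasurableSet D)
    (hcirc : ∀ w ∈ D, ∀ ζ : ℂ, ‖ζ‖ ≤ 1 → complexMul n ζ w ∈ D) (hDΓ : ∀ w ∈ D, y + w.2 ∈ Γ) :
    volume D * ‖F (cpoint x y)‖ₑ ^ p ≤
      ∫⁻ w in D, ‖F (cpoint (x + w.1) (y + w.2))‖ₑ ^ p := by
  set H : EuclideanSpace ℝ (Fin n) × EuclideanSpace ℝ (Fin n) → ENNReal :=
    fun w => ‖F (cpoint (x + w.1) (y + w.2))‖ₑ ^ p with hH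
  have hHm : Measurable H := by
    have : Measurable fun w : EuclideanSpace ℝ (Fin n) × EuclideanSpace ℝ (Fin n) =>
        F (cpoint (x + w.1) (y + w.2)) :=
      hm.comp (measurable_cpoint.comp (by fun_prop :
        Measurable fun w : EuclideanSpace ℝ (Fin n) × EuclideanSpace ℝ (Fin n) =>
          (x + w.1, y + w.2)))
    exact this.enorm.pow_const p
  -- For each displacement, use the mean value inequality on the complex disc `ζ ↦ z + ζ w`.
  -- Averaging over `D` and rotating back, which preserves both `D` and the measure, removes the
  -- circle integral.
  have hpt : ∀ w ∈ D, ‖F (cpoint x y)‖ₑ ^ p ≤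
      ∫⁻ θ, H (complexMul n (circleMap 0 1 θ) w) ∂circleProb := by
    intro w hw
    have hin : ∀ ζ : ℂ, ‖ζ‖ ≤ 1 → cpoint x y + ζ • cpoint w.1 w.2 ∈ tube Γ := fun ζ hζ => by
      rw [cpoint_add_smul, cpoint_mem_tube]
      exact hDΓ _ (hcirc w hw ζ hζ)
    have hdiff : ∀ ζ : ℂ, ‖ζ‖ ≤ 1 →
        DifferentiableAt ℂ (fun ζ : ℂ => F (cpoint x y + ζ • cpoint w.1 w.2)) ζ := fun ζ hζ => by
      have h1 : DifferentiableAt ℂ F (cpoint x y + ζ • cpoint w.1 w.2) :=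
        (hF _ (hin ζ hζ)).differentiableAt ((isOpen_tube hΓ).mem_nhds (hin ζ hζ))
      exact h1.comp ζ (f := fun ζ : ℂ => cpoint x y + ζ • cpoint w.1 w.2) (by fun_prop)
    obtain ⟨B, hB⟩ := (isCompact_closedBall (0 : ℂ) 1).exists_bound_of_continuousOn
      (f := fun ζ : ℂ => F (cpoint x y + ζ • cpoint w.1 w.2))
      (fun ζ hζ => (hdiff ζ (by simpa using hζ)).continuousAt.continuousWithinAt)
    have := enorm_rpow_le_lintegral_circle hp
      (f := fun ζ : ℂ => F (cpoint x y + ζ • cpoint w.1 w.2))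
      (g := fun θ => F (cpoint x y + circleMap 0 1 θ • cpoint w.1 w.2)) (B := B)
      (fun ζ hζ => (hdiff ζ (by simpa using (mem_ball_zero_iff.1 hζ).le)).differentiableWithinAt)
      (fun ζ hζ => hB ζ (Metric.ball_subset_closedBall hζ))
      (ae_of_all _ fun θ => by
        have hc : Tendsto (fun r : ℝ => circleMap 0 r θ) (𝓝[<] 1) (𝓝 (circleMap 0 1 θ)) := by
          refine Tendsto.mono_left (Continuous.tendsto ?_ 1) nhdsWithin_le_nhds
          unfold circleMap
          fun_prop
        exact (hdiff (circleMap 0 1 θ) (by simp)).continuousAt.tendsto.comp hc)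
    simpa only [zero_smul, add_zero, cpoint_add_smul] using this
  have hjoint : Measurable fun q : (EuclideanSpace ℝ (Fin n) × EuclideanSpace ℝ (Fin n)) × ℝ =>
      H (complexMul n (circleMap 0 1 q.2) q.1) := by
    refine hHm.comp ?_
    have hc : Measurable fun q : (EuclideanSpace ℝ (Fin n) × EuclideanSpace ℝ (Fin n)) × ℝ =>
      circleMap 0 1 q.2 := (continuous_circleMap 0 1).measurable.comp measurable_snd
    simp only [complexMul_apply]
    have h1 := Complex.measurable_re.comp hc
    have h2 := Complex.measurable_im.comp hc
    have h3 : Measurable fun q : (EuclideanSpace ℝ (Fin n) × EuclideanSpace ℝ (Fin n)) × ℝ =>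
      q.1.1 := measurable_fst.comp measurable_fst
    have h4 : Measurable fun q : (EuclideanSpace ℝ (Fin n) × EuclideanSpace ℝ (Fin n)) × ℝ =>
      q.1.2 := measurable_snd.comp measurable_fst
    exact ((h1.smul h3).sub (h2.smul h4)).prodMk ((h1.smul h4).add (h2.smul h3))
  calc volume D * ‖F (cpoint x y)‖ₑ ^ p = ∫⁻ _ in D, ‖F (cpoint x y)‖ₑ ^ p := by
        rw [setLIntegral_const, mul_comm]
    _ ≤ ∫⁻ w in D, ∫⁻ θ, H (complexMul n (circleMap 0 1 θ) w) ∂circleProb :=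
        setLIntegral_mono' hD hpt
    _ = ∫⁻ θ, (∫⁻ w in D, H (complexMul n (circleMap 0 1 θ) w)) ∂circleProb :=
        lintegral_lintegral_swap hjoint.aemeasurable
    _ ≤ ∫⁻ _θ, (∫⁻ w in D, H w) ∂circleProb := by
        refine lintegral_mono fun θ => ?_
        have hn : ‖circleMap 0 1 θ‖ = 1 := by simp
        calc ∫⁻ w in D, H (complexMul n (circleMap 0 1 θ) w)
            = ∫⁻ w in D, D.indicator H (complexMul n (circleMap 0 1 θ) w) :=
              setLIntegral_congr_fun hD fun w hw =>
                (Set.indicator_of_mem (hcirc w hw _ hn.le) H).symm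
          _ ≤ ∫⁻ w, D.indicator H (complexMul n (circleMap 0 1 θ) w) := setLIntegral_le_lintegral _ _
          _ = ∫⁻ w, D.indicator H w :=
              (measurePreserving_complexMul hn).lintegral_comp (hHm.indicator hD)
          _ = ∫⁻ w in D, H w := lintegral_indicator hD _
    _ = ∫⁻ w in D, H w := by simp

/-- Functions in the Hardy space are controlled pointwise by the diagonal kernel. -/
theorem exists_pointwise_bound (n : ℕ) {p : ℝ} (hp : 1 ≤ p) : ∃ A : ENNReal, A ≠ ⊤ ∧
    ∀ {Γ : Set (EuclideanSpace ℝ (Fin n))} {F : EuclideanSpace ℂ (Fin n) → ℂ},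
      IsRegularCone Γ → Measurable F → DifferentiableOn ℂ F (tube Γ) → ∀ M : ENNReal,
      (∀ y ∈ Γ, ∫⁻ x, ‖F (cpoint x y)‖ₑ ^ p ≤ M) → ∀ x, ∀ y ∈ Γ,
        ‖F (cpoint x y)‖ₑ ^ p ≤ A * ENNReal.ofReal (diagKernel Γ y) * M := by
  obtain ⟨C, hC, hdet⟩ := exists_det_le_diagKernel n
  set r : ℝ := ((n : ℝ) + 1)⁻¹ with hr
  have hr0 : 0 < r := by positivity
  set V := volume (cube n r) with hV
  set V' := volume (cube n (r / 2)) with hV'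
  have hV'0 : V' ≠ 0 := volume_cube_ne_zero (by positivity)
  have hV'T : V' ≠ ⊤ := volume_cube_ne_top _
  refine ⟨ENNReal.ofReal C * V * (V' * V')⁻¹, ?_, fun {Γ F} h hm hF M hM x y hy => ?_⟩
  · exact ENNReal.mul_ne_top (ENNReal.mul_ne_top ENNReal.ofReal_ne_top (volume_cube_ne_top _))
      (ENNReal.inv_ne_top.2 (mul_ne_zero hV'0 hV'0))
  obtain ⟨t, ht, ht0, hts⟩ := h.exists_auerbach hy
  set d := |(rowMatrix t).det| with hd
  have hd0 : 0 < d := abs_pos.2 ht0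
  set L : EuclideanSpace ℝ (Fin n) × EuclideanSpace ℝ (Fin n) → Fin n → ℂ :=
    fun w i => ⟨inner ℝ w.1 (t i), inner ℝ w.2 (t i)⟩ with hL
  have hLmul : ∀ ζ w i, L (complexMul n ζ w) i = ζ * L w i := fun ζ w i => by
    apply Complex.ext <;>
      simp [hL, complexMul_apply, inner_add_left, inner_sub_left, real_inner_smul_left]
  -- A polydisc in the coordinates `z · tᵢ`: circled, with imaginary parts in the parallelepiped
  -- that keeps `y + w.2` in the cone.
  set D : Set (EuclideanSpace ℝ (Fin n) × EuclideanSpace ℝ (Fin n)) :=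
    {w | ∀ i, ‖L w i‖ < r} with hD
  have hDm : MeasurableSet D := by
    have : D = ⋂ i, {w | ‖L w i‖ < r} := by ext; simp [hD]
    rw [this]
    refine (isOpen_iInter_of_finite fun i => isOpen_lt ?_ continuous_const).measurableSet
    have e : (fun w => ‖L w i‖) = fun w : EuclideanSpace ℝ (Fin n) × EuclideanSpace ℝ (Fin n) =>
        ‖((inner ℝ w.1 (t i) : ℝ) : ℂ) + ((inner ℝ w.2 (t i) : ℝ) : ℂ) * Complex.I‖ := by
      ext w
      congr 1
      exact (Complex.mk_eq_add_mul_I _ _)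
    rw [e]
    fun_prop
  have hDsub : D ⊆ Set.univ ×ˢ slab t r := fun w hw => ⟨trivial, fun i =>
    (Complex.abs_im_le_norm (L w i)).trans_lt (hw i)⟩
  have hsubD : slab t (r / 2) ×ˢ slab t (r / 2) ⊆ D := fun w hw i => by
    have h1 := hw.1 i
    have h2 := hw.2 i
    refine (Complex.norm_le_abs_re_add_abs_im _).trans_lt ?_
    simp only [hL]
    linarith
  have hmv := volume_mul_enorm_rpow_le hp h.isOpen hm hF (x := x) (y := y) hDm
    (fun w hw ζ hζ i => by
      rw [hLmul, norm_mul]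
      exact (mul_le_of_le_one_left (norm_nonneg _) hζ).trans_lt (hw i))
    (fun w hw => h.add_mem_of_mem_slab hy hts (hDsub hw).2)
  have hslab : ∀ s, MeasurableSet (slab t s) := fun s => by
    have : slab t s = ⋂ i, {u | |inner ℝ u (t i)| < s} := by ext; simp [slab]
    rw [this]
    exact (isOpen_iInter_of_finite fun i =>
      isOpen_lt (by fun_prop) continuous_const).measurableSet
  have hup : ∫⁻ w in D, ‖F (cpoint (x + w.1) (y + w.2))‖ₑ ^ p ≤ volume (slab t r) * M := by
    have hmeas : Measurable fun w : EuclideanSpace ℝ (Fin n) × EuclideanSpace ℝ (Fin n) =>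
        ‖F (cpoint (x + w.1) (y + w.2))‖ₑ ^ p :=
      ((hm.comp (measurable_cpoint.comp (by fun_prop :
        Measurable fun w : EuclideanSpace ℝ (Fin n) × EuclideanSpace ℝ (Fin n) =>
          (x + w.1, y + w.2)))).enorm).pow_const p
    calc _ ≤ ∫⁻ w in Set.univ ×ˢ slab t r, ‖F (cpoint (x + w.1) (y + w.2))‖ₑ ^ p :=
          lintegral_mono_set hDsub
      _ = ∫⁻ v in slab t r, ∫⁻ u, ‖F (cpoint (x + u) (y + v))‖ₑ ^ p := by
          rw [Measure.volume_eq_prod, ← Measure.prod_restrict, Measure.restrict_univ,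
            lintegral_prod_symm _ hmeas.aemeasurable]
      _ ≤ ∫⁻ _v in slab t r, M := by
          refine setLIntegral_mono' (hslab r) fun v hv => ?_
          rw [lintegral_add_left_eq_self (fun u => ‖F (cpoint u (y + v))‖ₑ ^ p) x]
          exact hM _ (h.add_mem_of_mem_slab hy hts hv)
      _ = volume (slab t r) * M := by rw [setLIntegral_const, mul_comm]
  have hlow : volume (slab t (r / 2)) * volume (slab t (r / 2)) ≤ volume D := by
    rw [← Measure.prod_prod]
    exact measure_mono hsubD
  -- Up to constants the volume of `D` is at least `d⁻²` and the integral over it is at most `d⁻¹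
  -- M`, which leaves `|F|^p ≲ d M`; finally `d ≤ C K(y)`.
  have hmain := ((mul_le_mul_left hlow (‖F (cpoint x y)‖ₑ ^ p)).trans hmv).trans hup
  rw [volume_slab ht0, volume_slab ht0, ← hV, ← hV', ← hd] at hmain
  set X := ‖F (cpoint x y)‖ₑ ^ p
  have hdi : ENNReal.ofReal d * ENNReal.ofReal d⁻¹ = 1 := by
    rw [← ENNReal.ofReal_mul hd0.le, mul_inv_cancel₀ hd0.ne', ENNReal.ofReal_one]
  have hVi : (V' * V')⁻¹ * (V' * V') = 1 :=
    ENNReal.inv_mul_cancel (mul_ne_zero hV'0 hV'0) (ENNReal.mul_ne_top hV'T hV'T)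
  calc X = (ENNReal.ofReal d * ENNReal.ofReal d⁻¹) * (ENNReal.ofReal d * ENNReal.ofReal d⁻¹) *
        ((V' * V')⁻¹ * (V' * V')) * X := by rw [hdi, hVi]; simp
    _ = (ENNReal.ofReal d * ENNReal.ofReal d * (V' * V')⁻¹) *
        (ENNReal.ofReal d⁻¹ * V' * (ENNReal.ofReal d⁻¹ * V') * X) := by ring
    _ ≤ (ENNReal.ofReal d * ENNReal.ofReal d * (V' * V')⁻¹) *
        (ENNReal.ofReal d⁻¹ * V * M) := by gcongr
    _ = ENNReal.ofReal d * (ENNReal.ofReal d * ENNReal.ofReal d⁻¹) * V * (V' * V')⁻¹ * M := by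
        ring
    _ = ENNReal.ofReal d * V * (V' * V')⁻¹ * M := by rw [hdi, mul_one]
    _ ≤ ENNReal.ofReal (C * diagKernel Γ y) * V * (V' * V')⁻¹ * M := by
        gcongr
        exact hdet h hy t ht
    _ = _ := by rw [ENNReal.ofReal_mul hC]; ring

end MeanValue

/-! ### Monotonicity of the slice norms. -/

section Contraction

/-- The Cayley transform of the unit disc onto the upper half-plane. -/
noncomputable def cayley (w : ℂ) : ℂ := Complex.I * (1 + w) / (1 - w)

theorem cayley_im (w : ℂ) : (cayley w).im = (1 - Complex.normSq w) / Complex.normSq (1 - w) := by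
  rw [cayley, Complex.div_im]
  simp [Complex.normSq_apply]
  ring

theorem continuousAt_cayley {w : ℂ} (hw : w ≠ 1) : ContinuousAt cayley w :=
  ContinuousAt.div (by fun_prop) (by fun_prop) (sub_ne_zero.2 hw.symm)

theorem measurable_slice (hm : Measurable F) (y : EuclideanSpace ℝ (Fin n)) :
    Measurable fun x => F (cpoint x y) :=
  hm.comp (measurable_cpoint.comp (measurable_id.prodMk measurable_const))

theorem differentiableAt_tube (hΓ : IsOpen Γ) (hF : DifferentiableOn ℂ F (tube Γ))
    {x y : EuclideanSpace ℝ (Fin n)} (hy : y ∈ Γ) : DifferentiableAt ℂ F (cpoint x y) :=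
  (hF _ (cpoint_mem_tube.2 hy)).differentiableAt
    ((isOpen_tube hΓ).mem_nhds (cpoint_mem_tube.2 hy))

/-- The `Lᵖ` norms over horizontal slices decrease in the directions of the cone. -/
theorem lintegral_slice_add_le (hp : 1 ≤ p) (h : IsRegularCone Γ) (hm : Measurable F)
    (hF : DifferentiableOn ℂ F (tube Γ)) {M : ENNReal} (hMT : M ≠ ⊤)
    (hM : ∀ y ∈ Γ, ∫⁻ x, ‖F (cpoint x y)‖ₑ ^ p ≤ M) {y s : EuclideanSpace ℝ (Fin n)}
    (hy : y ∈ Γ) (hs : s ∈ Γ) :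
    ∫⁻ x, ‖F (cpoint x (y + s))‖ₑ ^ p ≤ ∫⁻ x, ‖F (cpoint x y)‖ₑ ^ p := by
  have hp0 : 0 < p := by linarith
  obtain ⟨A, hA, hbound⟩ := exists_pointwise_bound n hp
  set b := A * ENNReal.ofReal (diagKernel Γ y) * M with hb
  have hbT : b ≠ ⊤ := ENNReal.mul_ne_top (ENNReal.mul_ne_top hA ENNReal.ofReal_ne_top) hMT
  -- The pointwise bound together with monotonicity of the kernel makes `F` bounded on `y + Γ`, as
  -- is needed to use boundary values on a half-plane.
  have hpt : ∀ x v : EuclideanSpace ℝ (Fin n), v ∈ Γ →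
      ‖F (cpoint x (y + v))‖ ≤ (b ^ (1 / p)).toReal := by
    intro x v hv
    have h1 := (hbound h hm hF M hM x (y + v) (h.add_mem' hy hv)).trans
      (show _ ≤ b by
        rw [hb]
        gcongr
        exact h.diagKernel_anti hy hv)
    have h2 := ENNReal.rpow_le_rpow h1 (show 0 ≤ 1 / p by positivity)
    rw [← ENNReal.rpow_mul, mul_one_div_cancel hp0.ne', ENNReal.rpow_one] at h2
    have h3 := ENNReal.toReal_mono (ENNReal.rpow_ne_top_of_nonneg (by positivity) hbT) h2
    rwa [toReal_enorm] at h3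
  have hpos : ∀ w ∈ Metric.ball (0 : ℂ) 1, 0 < (cayley w).im := by
    intro w hw
    rw [mem_ball_zero_iff] at hw
    have hw1 : w ≠ 1 := fun h1 => by simp [h1] at hw
    rw [cayley_im]
    refine div_pos ?_ (Complex.normSq_pos.2 (sub_ne_zero.2 hw1.symm))
    rw [Complex.normSq_eq_norm_sq]
    nlinarith [norm_nonneg w]
  have him : ∀ θ, (cayley (circleMap 0 1 θ)).im = 0 := fun θ => by
    rw [cayley_im, Complex.normSq_eq_norm_sq]
    simp
  have hpoint : ∀ x (ζ : ℂ), cpoint x y + ζ • cpoint s 0 =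
      cpoint (x + ζ.re • s) (y + ζ.im • s) := fun x ζ => by
    rw [cpoint_add_smul ζ x y (s, 0), complexMul_apply]
    simp
  -- `ζ ↦ F(x + iy + ζ s)` lives on the upper half-plane; `cayley` sends the centre of the disc to
  -- `i`, giving height `y + s`, and the circle minus 1 to the real line, giving translates at
  -- height `y`. Integration in `x` erases the translations.
  have hslice : ∀ x, ‖F (cpoint x (y + s))‖ₑ ^ p ≤
      ∫⁻ θ, ‖F (cpoint (x + (cayley (circleMap 0 1 θ)).re • s) y)‖ₑ ^ p ∂circleProb := by
    intro x
    have := enorm_rpow_le_lintegral_circle hp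
      (f := fun w => F (cpoint x y + cayley w • cpoint s 0))
      (g := fun θ => F (cpoint (x + (cayley (circleMap 0 1 θ)).re • s) y))
      (B := (b ^ (1 / p)).toReal) ?_ ?_ ?_
    · rw [hpoint] at this
      simpa [cayley] using this
    · intro w hw
      have hw1 : w ≠ 1 := fun h1 => by simp [h1] at hw
      have hd : DifferentiableAt ℂ F (cpoint x y + cayley w • cpoint s 0) := by
        rw [hpoint]
        exact differentiableAt_tube h.isOpen hF (h.add_mem' hy (h.smul_mem hs (hpos w hw)))
      have hc : DifferentiableAt ℂ cayley w :=
        DifferentiableAt.div (by fun_prop) (by fun_prop) (sub_ne_zero.2 hw1.symm)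
      exact (hd.comp w (f := fun w => cpoint x y + cayley w • cpoint s 0)
        ((hc.smul_const _).const_add _)).differentiableWithinAt
    · intro w hw
      simp only [hpoint]
      exact hpt _ _ (h.smul_mem hs (hpos w hw))
    -- On `(0, 2π]` only the angle `2π` gives the boundary point 1, which is sent to infinity.
    · have hne : ∀ᵐ θ ∂circleProb, θ ∈ Set.Ioc 0 (2 * Real.pi) ∧ θ ≠ 2 * Real.pi := by
        refine Measure.ae_smul_measure ?_ _
        filter_upwards [ae_restrict_mem measurableSet_Ioc,
          ae_restrict_of_ae (Measure.ae_ne volume (2 * Real.pi))] with θ h1 h2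
        exact ⟨h1, h2⟩
      filter_upwards [hne] with θ hθ
      have hθ1 : circleMap 0 1 θ ≠ 1 := by
        intro h1
        rw [circleMap, zero_add, Complex.ofReal_one, one_mul, Complex.exp_eq_one_iff] at h1
        obtain ⟨k, hk⟩ := h1
        have hk' : θ = k * (2 * Real.pi) := by
          have := congrArg Complex.im hk
          simpa using this
        have h2 := lt_of_le_of_ne hθ.1.2 hθ.2
        have h3 := hθ.1.1
        rw [hk'] at h2 h3
        have hk0 : (0 : ℝ) < k := pos_of_mul_pos_left h3 (by positivity)
        have hk1 : (k : ℝ) < 1 := by nlinarith [Real.pi_pos]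
        have h4 : (0 : ℤ) < k := by exact_mod_cast hk0
        have h5 : k < (1 : ℤ) := by exact_mod_cast hk1
        omega
      have hc : Tendsto (fun r : ℝ => circleMap 0 r θ) (𝓝[<] 1) (𝓝 (circleMap 0 1 θ)) := by
        refine Tendsto.mono_left (Continuous.tendsto ?_ 1) nhdsWithin_le_nhds
        unfold circleMap
        fun_prop
      have hin : cpoint x y + cayley (circleMap 0 1 θ) • cpoint s 0 =
          cpoint (x + (cayley (circleMap 0 1 θ)).re • s) y := by
        rw [hpoint, him, zero_smul, add_zero]
      have hFc : ContinuousAt F (cpoint x y + cayley (circleMap 0 1 θ) • cpoint s 0) := by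
        rw [hin]
        exact (differentiableAt_tube h.isOpen hF hy).continuousAt
      rw [← hin]
      exact hFc.tendsto.comp
        ((((continuousAt_cayley hθ1).tendsto.comp hc).smul_const _).const_add _)
  have hjoint : Measurable fun q : EuclideanSpace ℝ (Fin n) × ℝ =>
      ‖F (cpoint (q.1 + (cayley (circleMap 0 1 q.2)).re • s) y)‖ₑ ^ p := by
    have hc : Measurable fun q : EuclideanSpace ℝ (Fin n) × ℝ =>
        circleMap 0 1 q.2 := (continuous_circleMap 0 1).measurable.comp measurable_snd
    have hcay : Measurable cayley := by
      unfold cayley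
      fun_prop
    have h1 := (Complex.measurable_re.comp (hcay.comp hc)).smul_const s
    exact (((measurable_slice hm y).comp (measurable_fst.add h1)).enorm).pow_const p
  calc ∫⁻ x, ‖F (cpoint x (y + s))‖ₑ ^ p
      ≤ ∫⁻ x, (∫⁻ θ, ‖F (cpoint (x + (cayley (circleMap 0 1 θ)).re • s) y)‖ₑ ^ p ∂circleProb) :=
        lintegral_mono hslice
    _ = ∫⁻ θ, (∫⁻ x, ‖F (cpoint (x + (cayley (circleMap 0 1 θ)).re • s) y)‖ₑ ^ p) ∂circleProb :=
        lintegral_lintegral_swap hjoint.aemeasurable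
    _ = ∫⁻ _θ, (∫⁻ x, ‖F (cpoint x y)‖ₑ ^ p) ∂circleProb := by
        refine lintegral_congr fun θ => ?_
        exact lintegral_add_right_eq_self (fun x => ‖F (cpoint x y)‖ₑ ^ p) _
    _ = ∫⁻ x, ‖F (cpoint x y)‖ₑ ^ p := by simp

end Contraction

/-! ### Uniform convexity of `|·|^p`. -/

section UniformConvexity

/-- Equal moduli: the plane is strictly convex. Different moduli: `s ↦ s ^ p` is strictly convex. -/
theorem norm_half_add_rpow_lt {p : ℝ} (hp : 1 < p) {a b : ℂ} (hab : a ≠ b) :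
    ‖(a + b) / 2‖ ^ p < (‖a‖ ^ p + ‖b‖ ^ p) / 2 := by
  have hp0 : 0 < p := by linarith
  have htri : ‖(a + b) / 2‖ ≤ (‖a‖ + ‖b‖) / 2 := by
    rw [norm_div, Complex.norm_ofNat]
    linarith [norm_add_le a b]
  rcases eq_or_ne ‖a‖ ‖b‖ with he | hne
  · have h1 : ‖(a + b) / 2‖ < ‖a‖ := by
      have := (norm_midpoint_lt_iff he).2 hab
      rwa [Complex.real_smul, Complex.ofReal_div, Complex.ofReal_one, Complex.ofReal_ofNat,
        one_div_mul_eq_div] at this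
    have := Real.rpow_lt_rpow (norm_nonneg _) h1 hp0
    rw [← he]
    linarith
  · have h1 := (strictConvexOn_rpow hp).2 (norm_nonneg a) (norm_nonneg b) hne
      (show (0 : ℝ) < 1 / 2 by norm_num) (show (0 : ℝ) < 1 / 2 by norm_num) (by norm_num)
    simp only [smul_eq_mul] at h1
    have h2 := Real.rpow_le_rpow (norm_nonneg _) htri hp0.le
    rw [show 1 / 2 * ‖a‖ + 1 / 2 * ‖b‖ = (‖a‖ + ‖b‖) / 2 by ring] at h1
    linarith

/-- Uniform convexity of the `p`-th power of the modulus. -/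
theorem exists_uniform_convexity {p : ℝ} (hp : 1 < p) {η : ℝ} (hη : 0 < η) :
    ∃ C : ℝ, 0 ≤ C ∧ ∀ a b : ℂ, ‖a - b‖ ^ p + C * ‖(a + b) / 2‖ ^ p ≤
      (η + C / 2) * (‖a‖ ^ p + ‖b‖ ^ p) := by
  have hp0 : 0 < p := by linarith
  -- Normalized pairs that are at least `η` apart form a compact set, on which the convexity gap has
  -- a positive minimum `c`; other normalized pairs are covered by the `η` term. Homogeneity then
  -- gives all pairs.
  set K : Set (ℂ × ℂ) := {w | ‖w.1‖ ^ p + ‖w.2‖ ^ p = 1 ∧ η ≤ ‖w.1 - w.2‖ ^ p} with hK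
  have hcont : ∀ {f : ℂ × ℂ → ℂ}, Continuous f → Continuous fun w => ‖f w‖ ^ p :=
    fun hf => hf.norm.rpow_const fun _ => Or.inr hp0.le
  have hle1 : ∀ w ∈ K, ‖w.1‖ ≤ 1 ∧ ‖w.2‖ ≤ 1 := by
    intro w hw
    have h1 := Real.rpow_nonneg (norm_nonneg w.1) p
    have h2 := Real.rpow_nonneg (norm_nonneg w.2) p
    have h3 := hw.1
    constructor <;> by_contra! hlt <;> linarith [Real.one_lt_rpow hlt hp0]
  have hKc : IsCompact K := by
    refine Metric.isCompact_of_isClosed_isBounded ?_ ?_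
    · exact (isClosed_eq ((hcont continuous_fst).add (hcont continuous_snd)) continuous_const).inter
        (isClosed_le continuous_const (hcont (continuous_fst.sub continuous_snd)))
    · refine Metric.isBounded_closedBall.subset (t := Metric.closedBall 0 1) fun w hw => ?_
      rw [mem_closedBall_zero_iff, Prod.norm_def]
      exact max_le (hle1 w hw).1 (hle1 w hw).2
  set gap : ℂ × ℂ → ℝ := fun w => (‖w.1‖ ^ p + ‖w.2‖ ^ p) / 2 - ‖(w.1 + w.2) / 2‖ ^ p with hgap
  have hgapc : Continuous gap :=
    (((hcont continuous_fst).add (hcont continuous_snd)).div_const 2).sub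
      (hcont ((continuous_fst.add continuous_snd).div_const 2))
  have hgap0 : ∀ w, 0 ≤ gap w := fun w => by
    rcases eq_or_ne w.1 w.2 with he | hne
    · have : (w.2 + w.2) / 2 = w.2 := by ring
      simp only [hgap, he, this]
      linarith
    · have := norm_half_add_rpow_lt hp hne
      simp only [hgap]
      linarith
  have hc : ∃ c > 0, ∀ w ∈ K, c ≤ gap w := by
    rcases K.eq_empty_or_nonempty with he | hne
    · exact ⟨1, one_pos, fun w hw => by simp [he] at hw⟩
    · obtain ⟨w, hw, hmin⟩ := hKc.exists_isMinOn hne hgapc.continuousOn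
      refine ⟨gap w, ?_, fun v hv => hmin hv⟩
      have hne' : w.1 ≠ w.2 := fun h0 => by
        have h1 := hw.2
        rw [h0, sub_self, norm_zero, Real.zero_rpow hp0.ne'] at h1
        linarith
      have := norm_half_add_rpow_lt hp hne'
      simp only [hgap]
      linarith
  obtain ⟨c, hc0, hc⟩ := hc
  -- On `K` one has `‖a - b‖ ≤ 2`, so this multiple of the gap dominates `‖a - b‖ ^ p`.
  refine ⟨2 ^ p / c, by positivity, fun a b => ?_⟩
  suffices hmain : ‖a - b‖ ^ p ≤ η * (‖a‖ ^ p + ‖b‖ ^ p) + 2 ^ p / c * gap (a, b) by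
    simp only [hgap] at hmain
    linarith
  have hnorm : ∀ a b : ℂ, ‖a‖ ^ p + ‖b‖ ^ p = 1 →
      ‖a - b‖ ^ p ≤ η + 2 ^ p / c * gap (a, b) := by
    intro a b h1
    rcases le_total η (‖a - b‖ ^ p) with hle | hle
    · have hw : (a, b) ∈ K := ⟨h1, hle⟩
      have h2 : ‖a - b‖ ≤ 2 := (norm_sub_le a b).trans (by linarith [(hle1 _ hw).1, (hle1 _ hw).2])
      have h3 := Real.rpow_le_rpow (norm_nonneg _) h2 hp0.le
      have h4 : (2 : ℝ) ^ p ≤ 2 ^ p / c * gap (a, b) := by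
        rw [div_mul_eq_mul_div, le_div_iff₀ hc0]
        exact mul_le_mul_of_nonneg_left (hc _ hw) (by positivity)
      linarith
    · have := mul_nonneg (show 0 ≤ (2 : ℝ) ^ p / c by positivity) (hgap0 (a, b))
      linarith
  set S := ‖a‖ ^ p + ‖b‖ ^ p with hS
  have hSn : 0 ≤ S := by positivity
  rcases hSn.eq_or_lt with h0 | hpos
  · have ha := Real.rpow_nonneg (norm_nonneg a) p
    have hb := Real.rpow_nonneg (norm_nonneg b) p
    have ha0 : a = 0 := by
      have : ‖a‖ ^ p = 0 := by linarith
      simpa using (Real.rpow_eq_zero (norm_nonneg a) hp0.ne').1 this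
    have hb0 : b = 0 := by
      have : ‖b‖ ^ p = 0 := by linarith
      simpa using (Real.rpow_eq_zero (norm_nonneg b) hp0.ne').1 this
    have := mul_nonneg (show 0 ≤ (2 : ℝ) ^ p / c by positivity) (hgap0 (a, b))
    rw [← h0, ha0, hb0, sub_self, norm_zero, Real.zero_rpow hp0.ne'] at *
    linarith
  · set l : ℝ := S ^ (-(1 / p)) with hl
    have hl0 : 0 < l := Real.rpow_pos_of_pos hpos _
    have hlp : l ^ p = S⁻¹ := by
      rw [hl, ← Real.rpow_mul hSn, neg_mul, one_div_mul_cancel hp0.ne', Real.rpow_neg_one]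
    have hsc : ∀ z : ℂ, ‖(l : ℂ) * z‖ ^ p = S⁻¹ * ‖z‖ ^ p := fun z => by
      rw [norm_mul, Complex.norm_real, Real.norm_eq_abs, abs_of_pos hl0,
        Real.mul_rpow hl0.le (norm_nonneg _), hlp]
    have h1 := hnorm (l * a) (l * b) (by
      rw [hsc, hsc, ← mul_add, ← hS, inv_mul_cancel₀ hpos.ne'])
    simp only [hgap] at h1 ⊢
    rw [← mul_sub, ← mul_add, mul_div_assoc, hsc, hsc, hsc, hsc] at h1
    have h2 := mul_le_mul_of_nonneg_left h1 hSn
    have hSS : S * S⁻¹ = 1 := mul_inv_cancel₀ hpos.ne'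
    calc ‖a - b‖ ^ p = S * (S⁻¹ * ‖a - b‖ ^ p) := by rw [← mul_assoc, hSS, one_mul]
      _ ≤ _ := h2
      _ = η * S + 2 ^ p / c * ((S * S⁻¹) * ((‖a‖ ^ p + ‖b‖ ^ p) / 2 - ‖(a + b) / 2‖ ^ p)) := by
          ring
      _ = _ := by rw [hSS, one_mul]

theorem exists_uniform_convexity_lintegral {p : ℝ} (hp : 1 < p) {η : ℝ} (hη : 0 < η) :
    ∃ C : ℝ, 0 ≤ C ∧ ∀ {α : Type*} [MeasurableSpace α] (μ : Measure α) {f g : α → ℂ},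
      Measurable f → Measurable g →
      ∫⁻ x, ‖f x - g x‖ₑ ^ p ∂μ + ENNReal.ofReal C * ∫⁻ x, ‖(f x + g x) / 2‖ₑ ^ p ∂μ ≤
        ENNReal.ofReal (η + C / 2) * (∫⁻ x, ‖f x‖ₑ ^ p ∂μ + ∫⁻ x, ‖g x‖ₑ ^ p ∂μ) := by
  have hp0 : 0 < p := by linarith
  obtain ⟨C, hC, hle⟩ := exists_uniform_convexity hp hη
  refine ⟨C, hC, fun {α} _ μ {f g} hf hg => ?_⟩
  have e : ∀ z : ℂ, ‖z‖ₑ ^ p = ENNReal.ofReal (‖z‖ ^ p) := fun z => by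
    rw [← ofReal_norm, ENNReal.ofReal_rpow_of_nonneg (norm_nonneg _) hp0.le]
  have m1 : Measurable fun x => ‖f x - g x‖ₑ ^ p := (hf.sub hg).enorm.pow_const p
  have m2 : Measurable fun x => ‖(f x + g x) / 2‖ₑ ^ p :=
    ((hf.add hg).div_const 2).enorm.pow_const p
  have m3 : Measurable fun x => ‖f x‖ₑ ^ p := hf.enorm.pow_const p
  have m4 : Measurable fun x => ‖g x‖ₑ ^ p := hg.enorm.pow_const p
  have m5 : Measurable fun x => ‖f x‖ₑ ^ p + ‖g x‖ₑ ^ p := m3.add m4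
  rw [← lintegral_const_mul _ m2, ← lintegral_add_left m1, ← lintegral_add_left m3,
    ← lintegral_const_mul _ m5]
  refine lintegral_mono fun x => ?_
  simp only [e]
  rw [← ENNReal.ofReal_mul hC, ← ENNReal.ofReal_add (by positivity) (by positivity),
    ← ENNReal.ofReal_add (by positivity) (by positivity), ← ENNReal.ofReal_mul (by positivity)]
  exact ENNReal.ofReal_le_ofReal (hle _ _)

end UniformConvexity

/-! ### Approximation by translates into the tube. -/

section Approximation

/-- A crude Minkowski inequality; it only serves to show that combinations of Hardy functions have
finite Hardy norm, so that contraction applies to them. -/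
theorem lintegral_rpow_le_of_norm_le_add {α : Type*} [MeasurableSpace α] (μ : Measure α)
    (hp : 0 ≤ p) {f g h : α → ℂ} (hf : Measurable f) (hle : ∀ x, ‖h x‖ ≤ ‖f x‖ + ‖g x‖) :
    ∫⁻ x, ‖h x‖ₑ ^ p ∂μ ≤ 2 ^ p * (∫⁻ x, ‖f x‖ₑ ^ p ∂μ + ∫⁻ x, ‖g x‖ₑ ^ p ∂μ) := by
  rw [← lintegral_add_left (hf.enorm.pow_const p),
    ← lintegral_const_mul' _ _ (ENNReal.rpow_ne_top_of_nonneg hp ENNReal.ofNat_ne_top)]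
  refine lintegral_mono fun x => ?_
  have h1 : ‖h x‖ₑ ≤ ‖f x‖ₑ + ‖g x‖ₑ := by
    simp only [← ofReal_norm]
    rw [← ENNReal.ofReal_add (norm_nonneg _) (norm_nonneg _)]
    exact ENNReal.ofReal_le_ofReal (hle x)
  have h2 : ‖f x‖ₑ + ‖g x‖ₑ ≤ 2 * max ‖f x‖ₑ ‖g x‖ₑ := by
    rw [two_mul]
    exact add_le_add (le_max_left _ _) (le_max_right _ _)
  refine (ENNReal.rpow_le_rpow (h1.trans h2) hp).trans ?_
  rw [ENNReal.mul_rpow_of_nonneg _ _ hp]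
  gcongr
  rcases le_total ‖f x‖ₑ ‖g x‖ₑ with h3 | h3
  · rw [max_eq_right h3]; exact le_add_self
  · rw [max_eq_left h3]; exact le_self_add

theorem cpoint_add_cpoint (x y v : EuclideanSpace ℝ (Fin n)) :
    cpoint x y + cpoint 0 v = cpoint x (y + v) := by
  ext j
  simp [cpoint]
  ring

theorem measurable_shift (hm : Measurable F) (v : EuclideanSpace ℝ (Fin n)) :
    Measurable fun z => F (z + cpoint 0 v) := hm.comp (measurable_id.add_const _)

theorem differentiableOn_shift (h : IsOpenCone Γ) (hF : DifferentiableOn ℂ F (tube Γ))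
    {v : EuclideanSpace ℝ (Fin n)} (hv : v ∈ Γ) :
    DifferentiableOn ℂ (fun z => F (z + cpoint 0 v)) (tube Γ) := by
  refine hF.comp (by fun_prop) ?_
  rintro _ ⟨x, y, hy, rfl⟩
  simp only [cpoint_add_cpoint]
  exact cpoint_mem_tube.2 (h.add_mem' hy hv)

theorem lintegral_shift_le {M : ENNReal} (h : IsOpenCone Γ)
    (hM : ∀ y ∈ Γ, ∫⁻ x, ‖F (cpoint x y)‖ₑ ^ p ≤ M) {v : EuclideanSpace ℝ (Fin n)}
    (hv : v ∈ Γ) {y : EuclideanSpace ℝ (Fin n)} (hy : y ∈ Γ) :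
    ∫⁻ x, ‖F (cpoint x y + cpoint 0 v)‖ₑ ^ p ≤ M := by
  simp only [cpoint_add_cpoint]
  exact hM _ (h.add_mem' hy hv)

/-- The slices of a Hardy function along a ray to the vertex are Cauchy in `Lᵖ`. -/
theorem exists_slice_cauchy (hp : 1 < p) (h : IsRegularCone Γ) (hm : Measurable F)
    (hF : DifferentiableOn ℂ F (tube Γ)) {M : ENNReal} (hMT : M ≠ ⊤)
    (hM : ∀ y ∈ Γ, ∫⁻ x, ‖F (cpoint x y)‖ₑ ^ p ≤ M) {v : EuclideanSpace ℝ (Fin n)}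
    (hv : v ∈ Γ) {η : ℝ} (hη : 0 < η) :
    ∃ ε₀ : ℝ, 0 < ε₀ ∧ ∀ ε ∈ Set.Ioo 0 ε₀, ∀ δ ∈ Set.Ioo 0 ε₀,
      ∫⁻ x, ‖F (cpoint x (ε • v)) - F (cpoint x (δ • v))‖ₑ ^ p ≤ ENNReal.ofReal η := by
  have hp0 : 0 < p := by linarith
  set N : ℝ → ENNReal := fun ε => ∫⁻ x, ‖F (cpoint x (ε • v))‖ₑ ^ p with hN
  set N₀ : ENNReal := ⨆ ε : Set.Ioi (0 : ℝ), N ε with hN₀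
  have hle : ∀ ε, 0 < ε → N ε ≤ N₀ := fun ε hε =>
    le_iSup (fun ε : Set.Ioi (0 : ℝ) => N ε) ⟨ε, hε⟩
  have hN₀T : N₀ ≠ ⊤ :=
    ((iSup_le fun ε => hM _ (h.smul_mem hv ε.2)).trans_lt hMT.lt_top).ne
  set m := N₀.toReal with hm0
  have hm0n : 0 ≤ m := ENNReal.toReal_nonneg
  have hN₀m : N₀ = ENNReal.ofReal m := (ENNReal.ofReal_toReal hN₀T).symm
  set η' := η / (4 * (m + 1)) with hη'
  have hη'0 : 0 < η' := by positivity
  obtain ⟨C, hC, hconv⟩ := exists_uniform_convexity_lintegral hp hη'0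
  set κ := η / (8 * (C + 1)) with hκ
  have hκ0 : 0 < κ := by positivity
  have hκE : ENNReal.ofReal κ ≠ 0 := by simpa using hκ0
  -- The plan: all slices have norm at most `N₀`, and the midpoint of two slices near the vertex has
  -- norm almost `N₀`, so uniform convexity makes the two slices close. The height `t` nearly
  -- attains the supremum.
  obtain ⟨t, ht, hNt⟩ : ∃ t : ℝ, 0 < t ∧ N₀ ≤ N t + ENNReal.ofReal κ := by
    by_contra! hcon
    have : N₀ + ENNReal.ofReal κ ≤ N₀ := by
      conv_lhs => rw [hN₀]
      have : Nonempty (Set.Ioi (0 : ℝ)) := ⟨⟨1, Set.mem_Ioi.2 one_pos⟩⟩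
      rw [ENNReal.iSup_add]
      exact iSup_le fun ε => (hcon ε ε.2).le
    exact (ENNReal.lt_add_right hN₀T hκE).not_ge this
  set I : ℝ × ℝ → ENNReal := fun q =>
    ∫⁻ x, ‖(F (cpoint x (q.1 • v + t • v)) + F (cpoint x (q.2 • v + t • v))) / 2‖ₑ ^ p with hI
  -- Fatou's lemma: at height `t`, inside the tube, the midpoints converge pointwise to the slice of
  -- `F`.
  have hliminf : N t ≤ liminf I (𝓝[>] (0 : ℝ) ×ˢ 𝓝[>] (0 : ℝ)) := by
    refine le_trans (lintegral_mono fun x => ?_) (lintegral_liminf_le fun q =>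
      ((((measurable_slice hm _).add (measurable_slice hm _)).div_const 2).enorm.pow_const p))
    have hcont : Tendsto (fun ε : ℝ => F (cpoint x (ε • v + t • v))) (𝓝[>] 0)
        (𝓝 (F (cpoint x (t • v)))) := by
      have h1 : ContinuousAt F (cpoint x ((0 : ℝ) • v + t • v)) := by
        rw [zero_smul, zero_add]
        exact (differentiableAt_tube h.isOpen hF (h.smul_mem hv ht)).continuousAt
      have h2 : Continuous fun ε : ℝ => cpoint x (ε • v + t • v) :=
        continuous_cpoint.comp (by fun_prop : Continuous fun ε : ℝ => (x, ε • v + t • v))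
      have h3 := (ContinuousAt.comp (f := fun ε : ℝ => cpoint x (ε • v + t • v)) (x := (0 : ℝ)) h1
        h2.continuousAt).tendsto
      simp only [Function.comp_def, zero_smul, zero_add] at h3
      exact h3.mono_left nhdsWithin_le_nhds
    have h4 := ((hcont.comp tendsto_fst).add (hcont.comp (tendsto_snd
      (f := 𝓝[>] (0 : ℝ))))).div_const 2
    have h5 := ((ENNReal.continuous_rpow_const (y := p)).tendsto _).comp h4.enorm
    have h6 := h5.liminf_eq
    rw [add_self_div_two] at h6
    exact h6.ge
  have hev : ∀ᶠ q in 𝓝[>] (0 : ℝ) ×ˢ 𝓝[>] (0 : ℝ), N t ≤ I q + ENNReal.ofReal κ := by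
    rcases eq_or_ne (N t) 0 with h0 | h0
    · exact Eventually.of_forall fun q => by simp [h0]
    · have hlt : N t - ENNReal.ofReal κ < N t :=
        ENNReal.sub_lt_self ((hle t ht).trans_lt hN₀T.lt_top).ne h0 hκE
      filter_upwards [eventually_lt_of_lt_liminf (hlt.trans_le hliminf)] with q hq
      exact tsub_le_iff_right.1 hq.le
  obtain ⟨ε₀, hε₀, hsub⟩ : ∃ ε₀ : ℝ, 0 < ε₀ ∧ ∀ ε ∈ Set.Ioo 0 ε₀, ∀ δ ∈ Set.Ioo 0 ε₀,
      N t ≤ I (ε, δ) + ENNReal.ofReal κ := by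
    obtain ⟨s, hs, hs'⟩ := mem_prod_same_iff.1 hev
    obtain ⟨ε₀, hε₀, hsub⟩ := mem_nhdsGT_iff_exists_Ioo_subset.1 hs
    exact ⟨ε₀, hε₀, fun ε hε δ hδ => hs' (Set.mk_mem_prod (hsub hε) (hsub hδ))⟩
  refine ⟨ε₀, hε₀, fun ε hε δ hδ => ?_⟩
  set J := ∫⁻ x, ‖(F (cpoint x (ε • v)) + F (cpoint x (δ • v))) / 2‖ₑ ^ p with hJ
  -- Contraction from height `a` to `a + t`, applied to the average of the translates of `F` by `ε -
  -- a` and `δ - a`; halving the minimum keeps both shifts positive.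
  have hIJ : I (ε, δ) ≤ J := by
    set a := min ε δ / 2 with ha
    have ha0 : 0 < a := half_pos (lt_min hε.1 hδ.1)
    have haε : 0 < ε - a := by linarith [min_le_left ε δ, hε.1]
    have haδ : 0 < δ - a := by linarith [min_le_right ε δ, hδ.1]
    have h1 := lintegral_slice_add_le hp.le h
      (F := fun z => (F (z + cpoint 0 ((ε - a) • v)) + F (z + cpoint 0 ((δ - a) • v))) / 2)
      (((measurable_shift hm _).add (measurable_shift hm _)).div_const 2)
      (by
        simp only [div_eq_mul_inv]
        exact ((differentiableOn_shift h.toIsOpenCone hF (h.smul_mem hv haε)).add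
          (differentiableOn_shift h.toIsOpenCone hF (h.smul_mem hv haδ))).mul_const _)
      (M := 2 ^ p * (M + M))
      (ENNReal.mul_ne_top (ENNReal.rpow_ne_top_of_nonneg hp0.le ENNReal.ofNat_ne_top)
        (ENNReal.add_ne_top.2 ⟨hMT, hMT⟩)) ?_ (y := a • v) (s := t • v)
      (h.smul_mem hv ha0) (h.smul_mem hv ht)
    · have e1 : ∀ b : ℝ, a • v + (b - a) • v = b • v := fun b => by module
      have e2 : ∀ b : ℝ, a • v + t • v + (b - a) • v = b • v + t • v := fun b => by module
      simpa only [cpoint_add_cpoint, e1, e2] using h1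
    · intro y hy
      refine (lintegral_rpow_le_of_norm_le_add volume hp0.le
        (f := fun x => F (cpoint x y + cpoint 0 ((ε - a) • v)))
        (g := fun x => F (cpoint x y + cpoint 0 ((δ - a) • v)))
        (measurable_slice (measurable_shift hm _) y) fun x => ?_).trans ?_
      · rw [norm_div, Complex.norm_ofNat]
        have := norm_add_le (F (cpoint x y + cpoint 0 ((ε - a) • v)))
          (F (cpoint x y + cpoint 0 ((δ - a) • v)))
        have := norm_nonneg (F (cpoint x y + cpoint 0 ((ε - a) • v)) +
          F (cpoint x y + cpoint 0 ((δ - a) • v)))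
        linarith
      · gcongr
        · exact lintegral_shift_le h.toIsOpenCone hM (h.smul_mem hv haε) hy
        · exact lintegral_shift_le h.toIsOpenCone hM (h.smul_mem hv haδ) hy
  have hkey := hconv volume (measurable_slice hm (ε • v)) (measurable_slice hm (δ • v))
  have hN₀J : N₀ ≤ J + ENNReal.ofReal (2 * κ) := by
    rw [two_mul, ENNReal.ofReal_add hκ0.le hκ0.le, ← add_assoc]
    exact hNt.trans (add_le_add ((hsub ε hε δ hδ).trans (add_le_add hIJ le_rfl)) le_rfl)
  have hfin : ENNReal.ofReal C * J ≠ ⊤ := by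
    refine ((le_add_self.trans hkey).trans_lt ?_).ne
    exact ENNReal.mul_lt_top ENNReal.ofReal_lt_top
      (ENNReal.add_lt_top.2 ⟨(hle ε hε.1).trans_lt hN₀T.lt_top,
        (hle δ hδ.1).trans_lt hN₀T.lt_top⟩)
  refine ENNReal.le_of_add_le_add_right hfin (hkey.trans ?_)
  calc ENNReal.ofReal (η' + C / 2) * (N ε + N δ)
      ≤ ENNReal.ofReal (η' + C / 2) * (N₀ + N₀) := by
        gcongr
        · exact hle ε hε.1
        · exact hle δ hδ.1
    _ = ENNReal.ofReal (2 * η') * N₀ + ENNReal.ofReal C * N₀ := by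
        rw [← add_mul, ← ENNReal.ofReal_add (by positivity) hC, ← two_mul, ← mul_assoc]
        congr 1
        rw [show (2 : ENNReal) = ENNReal.ofReal 2 by simp, ← ENNReal.ofReal_mul (by positivity)]
        congr 1
        ring
    _ ≤ ENNReal.ofReal (2 * η') * N₀ + ENNReal.ofReal C * (J + ENNReal.ofReal (2 * κ)) := by
        gcongr
    _ = ENNReal.ofReal (2 * η' * m + C * (2 * κ)) + ENNReal.ofReal C * J := by
        rw [hN₀m, ENNReal.ofReal_add (by positivity) (by positivity), ENNReal.ofReal_mul hC,
          ENNReal.ofReal_mul (by positivity : 0 ≤ 2 * η')]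
        ring
    _ ≤ ENNReal.ofReal η + ENNReal.ofReal C * J := by
        gcongr
        have h1 : η' * m ≤ η / 4 := by
          rw [hη', div_mul_eq_mul_div, div_le_div_iff₀ (by positivity) (by positivity)]
          nlinarith
        have h2 : C * κ ≤ η / 8 := by
          rw [hκ, mul_div_assoc', div_le_div_iff₀ (by positivity) (by positivity)]
          nlinarith
        linarith

/-- Translates of a Hardy function into the tube converge to it in the Hardy norm. -/
theorem exists_shift_approx (hp : 1 < p) (h : IsRegularCone Γ) (hm : Measurable F)
    (hF : DifferentiableOn ℂ F (tube Γ)) {M : ENNReal} (hMT : M ≠ ⊤)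
    (hM : ∀ y ∈ Γ, ∫⁻ x, ‖F (cpoint x y)‖ₑ ^ p ≤ M) {v : EuclideanSpace ℝ (Fin n)}
    (hv : v ∈ Γ) {η : ℝ} (hη : 0 < η) :
    ∃ ε : ℝ, 0 < ε ∧ ∀ y ∈ Γ,
      ∫⁻ x, ‖F (cpoint x y) - F (cpoint x y + cpoint 0 (ε • v))‖ₑ ^ p ≤ ENNReal.ofReal η := by
  have hp0 : 0 < p := by linarith
  obtain ⟨ε₀, hε₀, hcauchy⟩ := exists_slice_cauchy hp h hm hF hMT hM hv hη
  set ε := ε₀ / 2 with hε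
  have hε0 : 0 < ε := half_pos hε₀
  have hεv := h.smul_mem hv hε0
  refine ⟨ε, hε0, fun y hy => ?_⟩
  -- Every `y` lies above some `δ v` with `δ` small. Contraction reduces the estimate at `y` to
  -- height `δ v`, where it is the Cauchy estimate for `δ` and `δ + ε`, both below `ε₀`.
  obtain ⟨δ, hδ, hδΓ⟩ : ∃ δ ∈ Set.Ioo 0 ε, y - δ • v ∈ Γ := by
    have hc : Tendsto (fun δ : ℝ => y - δ • v) (𝓝[>] 0) (𝓝 (y - (0 : ℝ) • v)) :=
      Tendsto.mono_left (Continuous.tendsto (by fun_prop) 0) nhdsWithin_le_nhds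
    rw [zero_smul, sub_zero] at hc
    obtain ⟨δ, h1, h2⟩ := ((hc.eventually (h.isOpen.mem_nhds hy)).and
      (Ioo_mem_nhdsGT hε0)).exists
    exact ⟨δ, h2, h1⟩
  have h1 := lintegral_slice_add_le hp.le h
    (F := fun z => F z - F (z + cpoint 0 (ε • v)))
    (hm.sub (measurable_shift hm _))
    (hF.sub (differentiableOn_shift h.toIsOpenCone hF hεv))
    (M := 2 ^ p * (M + M))
    (ENNReal.mul_ne_top (ENNReal.rpow_ne_top_of_nonneg hp0.le ENNReal.ofNat_ne_top)
      (ENNReal.add_ne_top.2 ⟨hMT, hMT⟩)) ?_ (y := δ • v) (s := y - δ • v)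
    (h.smul_mem hv hδ.1) hδΓ
  · rw [add_sub_cancel] at h1
    refine h1.trans ?_
    simp only [cpoint_add_cpoint, ← add_smul]
    exact hcauchy δ ⟨hδ.1, by linarith [hδ.2]⟩ (δ + ε) ⟨by linarith [hδ.1], by linarith [hδ.2]⟩
  · intro w hw
    refine (lintegral_rpow_le_of_norm_le_add volume hp0.le
      (f := fun x => F (cpoint x w)) (g := fun x => F (cpoint x w + cpoint 0 (ε • v)))
      (measurable_slice hm w) fun x => norm_sub_le _ _).trans ?_
    gcongr
    · exact hM w hw
    · exact lintegral_shift_le h.toIsOpenCone hM hεv hw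

/-- A small Hardy norm gives a small multiple of the kernel as a pointwise bound. -/
theorem exists_norm_le_of_lintegral_le (n : ℕ) (hp : 1 ≤ p) {κ : ℝ} (hκ : 0 < κ) :
    ∃ η : ℝ, 0 < η ∧ ∀ {Γ : Set (EuclideanSpace ℝ (Fin n))} {F : EuclideanSpace ℂ (Fin n) → ℂ},
      IsRegularCone Γ → Measurable F → DifferentiableOn ℂ F (tube Γ) →
      (∀ y ∈ Γ, ∫⁻ x, ‖F (cpoint x y)‖ₑ ^ p ≤ ENNReal.ofReal η) → ∀ x, ∀ y ∈ Γ,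
        ‖F (cpoint x y)‖ ≤ κ * diagKernel Γ y ^ (1 / p) := by
  have hp0 : 0 < p := by linarith
  obtain ⟨A, hA, hbound⟩ := exists_pointwise_bound n hp
  set a := A.toReal with ha
  have ha0 : 0 ≤ a := ENNReal.toReal_nonneg
  -- The `+ 1` keeps the denominator positive when `a = 0`.
  refine ⟨κ ^ p / (a + 1), by positivity, fun {Γ F} h hm hF hη x y hy => ?_⟩
  have hk := h.diagKernel_pos hy
  have h1 := hbound h hm hF _ hη x y hy
  rw [← ENNReal.ofReal_toReal hA, ← ha, ← ENNReal.ofReal_mul ha0,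
    ← ENNReal.ofReal_mul (by positivity), ← ofReal_norm,
    ENNReal.ofReal_rpow_of_nonneg (norm_nonneg _) hp0.le,
    ENNReal.ofReal_le_ofReal_iff (by positivity)] at h1
  have h2 : a * diagKernel Γ y * (κ ^ p / (a + 1)) ≤ (κ * diagKernel Γ y ^ (1 / p)) ^ p := by
    rw [Real.mul_rpow hκ.le (by positivity), ← Real.rpow_mul hk.le, one_div_mul_cancel hp0.ne',
      Real.rpow_one, mul_div_assoc', div_le_iff₀ (by positivity)]
    have := mul_pos (Real.rpow_pos_of_pos hκ p) hk
    nlinarith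
  exact (Real.rpow_le_rpow_iff (norm_nonneg _) (by positivity) hp0).1 (h1.trans h2)

end Approximation

/-! ### Damping factors. -/

section Damping

theorem one_le_prod_of_one_le {ι : Type*} {s : Finset ι} {f : ι → ℝ} (h : ∀ i ∈ s, 1 ≤ f i) :
    1 ≤ ∏ i ∈ s, f i :=
  Finset.prod_induction f (fun a => 1 ≤ a) (fun _ _ => one_le_mul_of_one_le_of_one_le) le_rfl h

/-- The affine function `z ↦ 1 - i δ (z · t)`. -/
noncomputable def dampFactor (δ : ℝ) (t : EuclideanSpace ℝ (Fin n))
    (z : EuclideanSpace ℂ (Fin n)) : ℂ := 1 - Complex.I * δ * ∑ j, z j * (t j : ℂ)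

/-- The coefficient `-i` moves the nonnegative `y · t` into the real part, so on the tube the factor
has modulus at least 1 and can be inverted. -/
theorem dampFactor_cpoint_re (δ : ℝ) (t x y : EuclideanSpace ℝ (Fin n)) :
    (dampFactor δ t (cpoint x y)).re = 1 + δ * inner ℝ y t := by
  simp [dampFactor, cpoint, PiLp.inner_apply, mul_comm]

theorem one_le_norm_dampFactor {δ : ℝ} (hδ : 0 ≤ δ) {t : EuclideanSpace ℝ (Fin n)}
    (ht : t ∈ dualCone Γ) {y : EuclideanSpace ℝ (Fin n)} (hy : y ∈ Γ)
    (x : EuclideanSpace ℝ (Fin n)) : 1 ≤ ‖dampFactor δ t (cpoint x y)‖ := by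
  refine le_trans ?_ (Complex.re_le_norm _)
  rw [dampFactor_cpoint_re]
  linarith [mul_nonneg hδ (mem_dualCone.1 ht y hy)]

/-- A product of affine functions on the tube that tends to infinity in all directions, for a
ball of radius greater than `s` around `τ` inside the dual cone. -/
noncomputable def dampProd (δ s : ℝ) (τ : EuclideanSpace ℝ (Fin n))
    (z : EuclideanSpace ℂ (Fin n)) : ℂ :=
  dampFactor δ τ z * ∏ j, dampFactor δ (τ + s • EuclideanSpace.single j (1 : ℝ)) z

theorem differentiable_dampProd (δ s : ℝ) (τ : EuclideanSpace ℝ (Fin n)) :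
    Differentiable ℂ (dampProd δ s τ) := by
  unfold dampProd dampFactor
  fun_prop

variable {τ : EuclideanSpace ℝ (Fin n)} {r δ : ℝ}

theorem add_single_mem_dualCone (hr : 0 < r) (hτ : Metric.ball τ r ⊆ dualCone Γ) (j : Fin n) :
    τ + (r / 2) • EuclideanSpace.single j (1 : ℝ) ∈ dualCone Γ := hτ (by
  rw [Metric.mem_ball, dist_eq_norm, add_sub_cancel_left, norm_smul, PiLp.norm_single,
    norm_one, mul_one, Real.norm_eq_abs, abs_of_pos (half_pos hr)]
  linarith)

theorem one_le_norm_dampProd (hr : 0 < r) (hτ : Metric.ball τ r ⊆ dualCone Γ) (hδ : 0 ≤ δ)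
    {y : EuclideanSpace ℝ (Fin n)} (hy : y ∈ Γ) (x : EuclideanSpace ℝ (Fin n)) :
    1 ≤ ‖dampProd δ (r / 2) τ (cpoint x y)‖ := by
  rw [dampProd, norm_mul, norm_prod]
  exact one_le_mul_of_one_le_of_one_le
    (one_le_norm_dampFactor hδ (hτ (Metric.mem_ball_self hr)) hy x)
    (one_le_prod_of_one_le fun j _ => one_le_norm_dampFactor hδ (add_single_mem_dualCone hr hτ j) hy x)

theorem norm_apply_le_norm_dampProd (hr : 0 < r) (hτ : Metric.ball τ r ⊆ dualCone Γ)
    (hδ : 0 < δ) {y : EuclideanSpace ℝ (Fin n)} (hy : y ∈ Γ) (x : EuclideanSpace ℝ (Fin n))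
    (j : Fin n) :
    ‖cpoint x y j‖ ≤ 4 / (δ * r) * ‖dampProd δ (r / 2) τ (cpoint x y)‖ := by
  set z := cpoint x y with hz
  set a := dampFactor δ τ z with ha
  set b : Fin n → ℂ :=
    fun j => dampFactor δ (τ + (r / 2) • EuclideanSpace.single j (1 : ℝ)) z with hb
  have ha1 : 1 ≤ ‖a‖ := one_le_norm_dampFactor hδ.le (hτ (Metric.mem_ball_self hr)) hy x
  have hb1 : ∀ j, 1 ≤ ‖b j‖ := fun j =>
    one_le_norm_dampFactor hδ.le (add_single_mem_dualCone hr hτ j) hy x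
  have hprod : ‖dampProd δ (r / 2) τ z‖ = ‖a‖ * ∏ j, ‖b j‖ := by
    rw [dampProd, norm_mul, norm_prod]
  have hbP : ‖b j‖ ≤ ∏ j, ‖b j‖ := by
    rw [← Finset.mul_prod_erase _ _ (Finset.mem_univ j)]
    exact le_mul_of_one_le_right (norm_nonneg _) (one_le_prod_of_one_le fun i _ => hb1 i)
  -- Subtracting two factors isolates the coordinate `z j`, and each factor is bounded by the whole
  -- product because all the others have modulus at least 1.
  have hdiff : a - b j = Complex.I * ((δ * (r / 2) : ℝ) : ℂ) * z j := by
    have hsum : ∑ k, z k * (((τ + (r / 2) • EuclideanSpace.single j (1 : ℝ)) k : ℝ) : ℂ) =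
        ∑ k, z k * (τ k : ℂ) + z j * ((r / 2 : ℝ) : ℂ) := by
      have hk : ∀ k, z k * (((τ + (r / 2) • EuclideanSpace.single j (1 : ℝ)) k : ℝ) : ℂ) =
          z k * (τ k : ℂ) + if k = j then z k * ((r / 2 : ℝ) : ℂ) else 0 := fun k => by
        rcases eq_or_ne k j with rfl | hne
        · simp [mul_add]
        · simp [hne]
      simp only [hk, Finset.sum_add_distrib, Finset.sum_ite_eq', Finset.mem_univ, if_true]
    simp only [ha, hb, dampFactor, hsum]
    push_cast
    ring
  have h1 : δ * (r / 2) * ‖z j‖ ≤ ‖a‖ + ‖b j‖ := by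
    have h2 := norm_sub_le a (b j)
    rwa [hdiff, norm_mul, norm_mul, Complex.norm_I, one_mul, Complex.norm_real, Real.norm_eq_abs,
      abs_of_pos (by positivity)] at h2
  have h3 : ‖a‖ ≤ ‖a‖ * ∏ j, ‖b j‖ :=
    le_mul_of_one_le_right (norm_nonneg _) (one_le_prod_of_one_le fun i _ => hb1 i)
  have h4 : ‖b j‖ ≤ ‖a‖ * ∏ j, ‖b j‖ :=
    hbP.trans (le_mul_of_one_le_left (Finset.prod_nonneg fun i _ => norm_nonneg _) ha1)
  rw [hprod, div_mul_eq_mul_div, le_div_iff₀ (by positivity)]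
  linarith

theorem one_add_norm_le_norm_dampProd (hr : 0 < r) (hτ : Metric.ball τ r ⊆ dualCone Γ)
    (hδ : 0 < δ) {y : EuclideanSpace ℝ (Fin n)} (hy : y ∈ Γ) (x : EuclideanSpace ℝ (Fin n)) :
    1 + ‖x‖ + ‖y‖ ≤ (1 + 2 * (n * (4 / (δ * r)))) * ‖dampProd δ (r / 2) τ (cpoint x y)‖ := by
  set P := ‖dampProd δ (r / 2) τ (cpoint x y)‖ with hP
  have h1 : 1 ≤ P := one_le_norm_dampProd hr hτ hδ.le hy x
  have hj := norm_apply_le_norm_dampProd hr hτ hδ hy x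
  have hx : ‖x‖ ≤ n * (4 / (δ * r)) * P := by
    refine (norm_le_sum_abs x).trans ((Finset.sum_le_sum fun j _ => ?_).trans
      (b := ∑ _j : Fin n, 4 / (δ * r) * P) (by simp [mul_assoc]))
    refine le_trans ?_ (hj j)
    simpa [cpoint] using Complex.abs_re_le_norm (cpoint x y j)
  have hy' : ‖y‖ ≤ n * (4 / (δ * r)) * P := by
    refine (norm_le_sum_abs y).trans ((Finset.sum_le_sum fun j _ => ?_).trans
      (b := ∑ _j : Fin n, 4 / (δ * r) * P) (by simp [mul_assoc]))
    refine le_trans ?_ (hj j)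
    simpa [cpoint] using Complex.abs_im_le_norm (cpoint x y j)
  linarith

/-- Away from the boundary, damping changes a Hardy function little in the Hardy norm. -/
theorem exists_damp_approx (hp : 1 ≤ p) (h : IsRegularCone Γ) (hm : Measurable F)
    (hF : DifferentiableOn ℂ F (tube Γ)) {M : ENNReal} (hMT : M ≠ ⊤)
    (hM : ∀ y ∈ Γ, ∫⁻ x, ‖F (cpoint x y)‖ₑ ^ p ≤ M) {v : EuclideanSpace ℝ (Fin n)}
    (hv : v ∈ Γ) (hr : 0 < r) (hτ : Metric.ball τ r ⊆ dualCone Γ) (m : ℕ) {η : ℝ} (hη : 0 < η) :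
    ∃ δ : ℝ, 0 < δ ∧ ∀ y ∈ Γ, ∫⁻ x, ‖F (cpoint x (v + y)) *
      (1 - (dampProd δ (r / 2) τ (cpoint x (v + y)) ^ m)⁻¹)‖ₑ ^ p ≤ ENNReal.ofReal η := by
  have hp0 : 0 < p := by linarith
  have hinv : ∀ δ : ℝ, 0 ≤ δ → ∀ y ∈ Γ, ∀ x,
      ‖1 - (dampProd δ (r / 2) τ (cpoint x y) ^ m)⁻¹‖ ≤ 2 := fun δ hδ y hy x => by
    refine (norm_sub_le _ _).trans ?_
    rw [norm_one, norm_inv, norm_pow]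
    have := inv_le_one_of_one_le₀ (one_le_pow₀ (one_le_norm_dampProd hr hτ hδ hy x) (n := m))
    linarith
  have hmeas : ∀ δ : ℝ, Measurable fun z => F z * (1 - (dampProd δ (r / 2) τ z ^ m)⁻¹) := fun δ =>
    hm.mul (measurable_const.sub
      (((differentiable_dampProd δ (r / 2) τ).continuous.measurable).pow_const m).inv)
  have hbd : ∀ δ : ℝ, 0 ≤ δ → ∀ y ∈ Γ, ∀ x,
      ‖F (cpoint x y) * (1 - (dampProd δ (r / 2) τ (cpoint x y) ^ m)⁻¹)‖ ≤
        ‖F (cpoint x y)‖ + ‖F (cpoint x y)‖ := fun δ hδ y hy x => by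
    rw [norm_mul, ← mul_two]
    exact mul_le_mul_of_nonneg_left (hinv δ hδ y hy x) (norm_nonneg _)
  -- Dominated convergence on the single slice at `v`, since the damping tends to 1 with `δ → 0`;
  -- contraction then carries the bound to every `v + y`.
  have hlim : Tendsto (fun δ : ℝ => ∫⁻ x, ‖F (cpoint x v) *
      (1 - (dampProd δ (r / 2) τ (cpoint x v) ^ m)⁻¹)‖ₑ ^ p) (𝓝[>] 0) (𝓝 0) := by
    have h0 : ∫⁻ _x : EuclideanSpace ℝ (Fin n), (0 : ENNReal) = 0 := by simp
    rw [← h0]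
    refine tendsto_lintegral_filter_of_dominated_convergence
      (fun x => (‖F (cpoint x v)‖ₑ + ‖F (cpoint x v)‖ₑ) ^ p)
      (Eventually.of_forall fun δ => (measurable_slice (hmeas δ) v).enorm.pow_const p) ?_ ?_ ?_
    · filter_upwards [self_mem_nhdsWithin] with δ hδ
      refine ae_of_all _ fun x => ENNReal.rpow_le_rpow ?_ hp0.le
      simp only [← ofReal_norm]
      rw [← ENNReal.ofReal_add (norm_nonneg _) (norm_nonneg _)]
      exact ENNReal.ofReal_le_ofReal (hbd δ (le_of_lt hδ) v hv x)
    · simp only [← two_mul, ENNReal.mul_rpow_of_nonneg _ _ hp0.le]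
      rw [lintegral_const_mul' _ _ (ENNReal.rpow_ne_top_of_nonneg hp0.le ENNReal.ofNat_ne_top)]
      exact ENNReal.mul_ne_top (ENNReal.rpow_ne_top_of_nonneg hp0.le ENNReal.ofNat_ne_top)
        ((hM v hv).trans_lt hMT.lt_top).ne
    · refine ae_of_all _ fun x => ?_
      have hc : Continuous fun δ : ℝ => dampProd δ (r / 2) τ (cpoint x v) := by
        unfold dampProd dampFactor
        fun_prop
      have h1 : dampProd 0 (r / 2) τ (cpoint x v) = 1 := by simp [dampProd, dampFactor]
      have h2 := (hc.tendsto 0).mono_left (nhdsWithin_le_nhds (s := Set.Ioi 0))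
      rw [h1] at h2
      have h3 := ((((h2.pow m).inv₀ (by simp)).const_sub 1).const_mul (F (cpoint x v))).enorm
      have h4 := ((ENNReal.continuous_rpow_const (y := p)).tendsto _).comp h3
      simpa [hp0, Function.comp_def] using h4
  have hηE : 0 < ENNReal.ofReal η := by simpa using hη
  obtain ⟨δ, hδη, hδ⟩ := ((hlim.eventually (gt_mem_nhds hηE)).and self_mem_nhdsWithin).exists
  have hδ0 : 0 < δ := hδ
  refine ⟨δ, hδ0, fun y hy => le_trans ?_ hδη.le⟩
  refine lintegral_slice_add_le hp h (hmeas δ) ?_ (M := 2 ^ p * (M + M))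
    (ENNReal.mul_ne_top (ENNReal.rpow_ne_top_of_nonneg hp0.le ENNReal.ofNat_ne_top)
      (ENNReal.add_ne_top.2 ⟨hMT, hMT⟩)) (fun w hw => ?_) hv hy
  · refine hF.mul (DifferentiableOn.const_sub (DifferentiableOn.inv
      ((differentiable_dampProd δ (r / 2) τ).pow m).differentiableOn ?_) 1)
    rintro _ ⟨x, w, hw, rfl⟩ h0
    have := one_le_pow₀ (one_le_norm_dampProd hr hτ hδ0.le hw x) (n := m)
    rw [← norm_pow] at this
    simp only [Pi.pow_apply] at h0
    rw [h0, norm_zero] at this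
    linarith
  · refine (lintegral_rpow_le_of_norm_le_add volume hp0.le (f := fun x => F (cpoint x w))
      (g := fun x => F (cpoint x w)) (measurable_slice hm w) (hbd δ hδ0.le w hw)).trans ?_
    gcongr <;> exact hM w hw

end Damping

/-! ### The decay estimate and the three limits. -/

/-- Up to a small multiple of the kernel, a Hardy function decays rapidly at infinity. -/
theorem exists_norm_le_add_decay (hp : 1 < p) (h : IsRegularCone Γ) (hm : Measurable F)
    (hF : DifferentiableOn ℂ F (tube Γ)) {M : ENNReal} (hMT : M ≠ ⊤)
    (hM : ∀ y ∈ Γ, ∫⁻ x, ‖F (cpoint x y)‖ₑ ^ p ≤ M) {κ : ℝ} (hκ : 0 < κ) :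
    ∃ B : ℝ, 0 ≤ B ∧ ∀ x, ∀ y ∈ Γ, ‖F (cpoint x y)‖ ≤
      κ * diagKernel Γ y ^ (1 / p) + B * ((1 + ‖x‖ + ‖y‖) ^ (n + 1))⁻¹ := by
  have hp0 : 0 < p := by linarith
  obtain ⟨v, hv⟩ := h.nonempty
  obtain ⟨τ, r, hr, hτ⟩ := h.exists_ball_subset_dualCone
  obtain ⟨η, hη, hsmall⟩ := exists_norm_le_of_lintegral_le n hp.le (half_pos hκ)
  obtain ⟨ε, hε, happ⟩ := exists_shift_approx hp h hm hF hMT hM hv hη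
  set w := ε • v with hw
  have hwΓ : w ∈ Γ := h.smul_mem hv hε
  -- The power `n + 1` beats by one the possible decay `|y|⁻ⁿ` of the kernel.
  obtain ⟨δ, hδ, hdamp⟩ := exists_damp_approx hp.le h hm hF hMT hM hwΓ hr hτ (n + 1) hη
  set P : EuclideanSpace ℂ (Fin n) → ℂ := dampProd δ (r / 2) τ with hP
  have hP1 : ∀ x, ∀ y ∈ Γ, 1 ≤ ‖P (cpoint x y)‖ := fun x y hy =>
    one_le_norm_dampProd hr hτ hδ.le hy x
  obtain ⟨A, hA, hbound⟩ := exists_pointwise_bound n hp.le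
  set b := A * ENNReal.ofReal (diagKernel Γ w) * M with hb
  have hbT : b ≠ ⊤ := ENNReal.mul_ne_top (ENNReal.mul_ne_top hA ENNReal.ofReal_ne_top) hMT
  set B₁ := (b ^ (1 / p)).toReal with hB₁
  have hFB : ∀ x, ∀ y ∈ Γ, ‖F (cpoint x (w + y))‖ ≤ B₁ := by
    intro x y hy
    have h1 := (hbound h hm hF M hM x (w + y) (h.add_mem' hwΓ hy)).trans
      (show _ ≤ b by
        rw [hb]
        gcongr
        exact h.diagKernel_anti hwΓ hy)
    have h2 := ENNReal.rpow_le_rpow h1 (show 0 ≤ 1 / p by positivity)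
    rw [← ENNReal.rpow_mul, mul_one_div_cancel hp0.ne', ENNReal.rpow_one] at h2
    have h3 := ENNReal.toReal_mono (ENNReal.rpow_ne_top_of_nonneg (by positivity) hbT) h2
    rwa [toReal_enorm] at h3
  -- The factor `1 + ‖w‖` passes from the size of `w + y` to that of `y`.
  set c := (1 + ‖w‖) * (1 + 2 * (n * (4 / (δ * r)))) with hc
  have hc0 : 0 < c := by positivity
  have hB₁n : 0 ≤ B₁ := ENNReal.toReal_nonneg
  refine ⟨B₁ * c ^ (n + 1), by positivity, fun x y hy => ?_⟩
  have hwy := h.add_mem' hwΓ hy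
  have hdiffP : DifferentiableOn ℂ (fun z => F z * (1 - (P z ^ (n + 1))⁻¹)) (tube Γ) := by
    refine hF.mul (DifferentiableOn.const_sub (DifferentiableOn.inv
      ((differentiable_dampProd δ (r / 2) τ).pow (n + 1)).differentiableOn ?_) 1)
    rintro _ ⟨x, w, hw, rfl⟩ h0
    have := one_le_pow₀ (hP1 x w hw) (n := n + 1)
    rw [← norm_pow] at this
    simp only [Pi.pow_apply] at h0
    rw [hP, h0, norm_zero] at this
    linarith
  have t1 := hsmall h (hm.sub (measurable_shift hm w))
    (hF.sub (differentiableOn_shift h.toIsOpenCone hF hwΓ)) happ x y hy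
  have t2 := hsmall h (F := fun z => F (z + cpoint 0 w) * (1 - (P (z + cpoint 0 w) ^ (n + 1))⁻¹))
    (measurable_shift (hm.mul (measurable_const.sub
      (((differentiable_dampProd δ (r / 2) τ).continuous.measurable).pow_const (n + 1)).inv)) w)
    (differentiableOn_shift h.toIsOpenCone hdiffP hwΓ)
    (fun y hy => by
      simp only [cpoint_add_cpoint, add_comm _ w]
      exact hdamp y hy) x y hy
  simp only [Pi.sub_apply, cpoint_add_cpoint, add_comm y w] at t1 t2
  have t3 : ‖F (cpoint x (w + y)) * (P (cpoint x (w + y)) ^ (n + 1))⁻¹‖ ≤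
      B₁ * c ^ (n + 1) * ((1 + ‖x‖ + ‖y‖) ^ (n + 1))⁻¹ := by
    rw [norm_mul, norm_inv, norm_pow, mul_assoc]
    refine mul_le_mul (hFB x y hy) ?_ (by positivity) hB₁n
    have hPpos : 0 < ‖P (cpoint x (w + y))‖ := one_pos.trans_le (hP1 x _ hwy)
    rw [← inv_pow, ← inv_pow, ← mul_pow]
    refine pow_le_pow_left₀ (by positivity) ?_ _
    rw [← div_eq_mul_inv, le_div_iff₀ (by positivity), inv_mul_le_iff₀ hPpos]
    have h1 := one_add_norm_le_norm_dampProd hr hτ hδ hwy x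
    have h2 : ‖y‖ ≤ ‖w + y‖ + ‖w‖ := by
      have := norm_sub_le (w + y) w
      rwa [add_sub_cancel_left] at this
    have h3 : 1 + ‖x‖ + ‖y‖ ≤ (1 + ‖w‖) * (1 + ‖x‖ + ‖w + y‖) := by
      nlinarith [norm_nonneg w, norm_nonneg x, norm_nonneg (w + y),
        mul_nonneg (norm_nonneg w) (norm_nonneg x),
        mul_nonneg (norm_nonneg w) (norm_nonneg (w + y))]
    calc 1 + ‖x‖ + ‖y‖ ≤ (1 + ‖w‖) * (1 + ‖x‖ + ‖w + y‖) := h3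
      _ ≤ (1 + ‖w‖) * ((1 + 2 * (n * (4 / (δ * r)))) * ‖P (cpoint x (w + y))‖) := by gcongr
      _ = ‖P (cpoint x (w + y))‖ * c := by rw [hc]; ring
  -- Translation error, damping error, and the damped translate: the first two each cost `κ / 2`
  -- times `K(y)^{1/p}`, the third decays.
  have hsplit : F (cpoint x y) = (F (cpoint x y) - F (cpoint x (w + y))) +
      F (cpoint x (w + y)) * (1 - (P (cpoint x (w + y)) ^ (n + 1))⁻¹) +
      F (cpoint x (w + y)) * (P (cpoint x (w + y)) ^ (n + 1))⁻¹ := by ring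
  have h4 := norm_add₃_le (a := F (cpoint x y) - F (cpoint x (w + y)))
    (b := F (cpoint x (w + y)) * (1 - (P (cpoint x (w + y)) ^ (n + 1))⁻¹))
    (c := F (cpoint x (w + y)) * (P (cpoint x (w + y)) ^ (n + 1))⁻¹)
  rw [← hsplit] at h4
  linarith

end TubeHardy

theorem theorem4p3 {n : ℕ} (Γ : Set (EuclideanSpace ℝ (Fin n)))
    (hΓ : TubeHardy.IsRegularCone Γ)
    (hK : TubeHardy.KernelVanishesAtInfinity Γ ∨ n = 2 ∨
      TubeHardy.IsPolygonalCone Γ ∨ TubeHardy.IsCircularCone Γ)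
    (p : ℝ) (hp : 1 < p)
    (F : EuclideanSpace ℂ (Fin n) → ℂ) (hF : TubeHardy.MemHardy p Γ F) :
    (∀ β ∈ frontier Γ,
      TendstoUniformly
        (fun (y x : EuclideanSpace ℝ (Fin n)) =>
          TubeHardy.kernelRatio p Γ F (TubeHardy.cpoint x y))
        (fun _ => 0) (𝓝[Γ] β)) ∧
    TendstoUniformly
      (fun (y x : EuclideanSpace ℝ (Fin n)) =>
        TubeHardy.kernelRatio p Γ F (TubeHardy.cpoint x y))
      (fun _ => 0) (Bornology.cobounded (EuclideanSpace ℝ (Fin n)) ⊓ 𝓟 Γ) ∧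
    TendstoUniformlyOn
      (fun (x y : EuclideanSpace ℝ (Fin n)) =>
        TubeHardy.kernelRatio p Γ F (TubeHardy.cpoint x y))
      (fun _ => 0) (Bornology.cobounded (EuclideanSpace ℝ (Fin n))) Γ := by
  open TubeHardy in
  have hp0 : 0 < p := by linarith
  -- The alternatives in `hK` are not needed: the argument works for every regular cone.
  -- Passing to the extension by zero makes the function globally measurable.
  have key : ∀ κ : ℝ, 0 < κ → ∃ B : ℝ, 0 ≤ B ∧ ∀ x, ∀ y ∈ Γ, ‖F (cpoint x y)‖ ≤
      κ * diagKernel Γ y ^ (1 / p) + B * ((1 + ‖x‖ + ‖y‖) ^ (n + 1))⁻¹ := by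
    intro κ hκ
    have hopen := isOpen_tube hΓ.isOpen
    have heq : ∀ x, ∀ y ∈ Γ, (tube Γ).indicator F (cpoint x y) = F (cpoint x y) :=
      fun x y hy => Set.indicator_of_mem (cpoint_mem_tube.2 hy) F
    have hmeas : Measurable ((tube Γ).indicator F) := by
      classical
      rw [← Set.piecewise_eq_indicator]
      exact hF.holomorphic.continuousOn.measurable_piecewise continuousOn_const
        hopen.measurableSet
    obtain ⟨B, hB, hle⟩ := exists_norm_le_add_decay hp hΓ hmeas
      (hF.holomorphic.congr fun z hz => Set.indicator_of_mem hz F) hF.bounded.ne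
      (fun y hy => by
        simp only [heq _ y hy]
        exact le_iSup₂ (f := fun y (_ : y ∈ Γ) => ∫⁻ x, ‖F (cpoint x y)‖ₑ ^ p) y hy) hκ
    exact ⟨B, hB, fun x y hy => heq x y hy ▸ hle x y hy⟩
  have hratio : ∀ x y, dist 0 (kernelRatio p Γ F (cpoint x y)) =
      |‖F (cpoint x y)‖ / diagKernel Γ y ^ (1 / p)| := fun x y => by
    rw [kernelRatio_eq, dist_zero_left, Real.norm_eq_abs]
  have hrate : ∀ e : ℝ, 0 < e → ∃ R : ℝ, ∀ x, ∀ y ∈ Γ, R < ‖x‖ + ‖y‖ →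
      dist 0 (kernelRatio p Γ F (cpoint x y)) < e := by
    intro e he
    obtain ⟨B, hB, hle⟩ := key (e / 2) (half_pos he)
    obtain ⟨c, hc, hk⟩ := hΓ.exists_le_diagKernel
    -- With the lower bound at most 1, raising it to the power `1 / p ≤ 1` does not decrease it, so
    -- it also bounds `K(y)^{1/p}` from below.
    set c' := min c 1 with hc'
    have hc'0 : 0 < c' := lt_min hc one_pos
    refine ⟨2 * B / (e * c'), fun x y hy hR => ?_⟩
    have hkpos := hΓ.diagKernel_pos hy
    have hkp : 0 < diagKernel Γ y ^ (1 / p) := Real.rpow_pos_of_pos hkpos _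
    have hq0 : 0 < c' * ((1 + ‖y‖) ^ n)⁻¹ := by positivity
    have hq1 : c' * ((1 + ‖y‖) ^ n)⁻¹ ≤ 1 :=
      mul_le_one₀ (min_le_right _ _) (by positivity)
        (inv_le_one_of_one_le₀ (one_le_pow₀ (by linarith [norm_nonneg y])))
    have hlow : c' * ((1 + ‖y‖) ^ n)⁻¹ ≤ diagKernel Γ y ^ (1 / p) := by
      have h1 : c' * ((1 + ‖y‖) ^ n)⁻¹ ≤ diagKernel Γ y :=
        (mul_le_mul_of_nonneg_right (min_le_left _ _) (by positivity)).trans (hk y hy)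
      refine le_trans ?_ (Real.rpow_le_rpow hq0.le h1 (by positivity : 0 ≤ 1 / p))
      have h2 := Real.rpow_le_rpow_of_exponent_ge hq0 hq1
        (show 1 / p ≤ 1 by rw [div_le_one hp0]; exact hp.le)
      rwa [Real.rpow_one] at h2
    rw [hratio, abs_of_nonneg (by positivity), div_lt_iff₀ hkp]
    refine (hle x y hy).trans_lt ?_
    have hS : 0 < 1 + ‖x‖ + ‖y‖ := by positivity
    have h3 : B * ((1 + ‖x‖ + ‖y‖) ^ (n + 1))⁻¹ < e / 2 * (c' * ((1 + ‖y‖) ^ n)⁻¹) := by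
      -- Of the `n + 1` powers, `n` are spent on the kernel; the remaining one tends to zero as `|x|
      -- + |y|` grows.
      have h4 : ((1 + ‖x‖ + ‖y‖) ^ (n + 1))⁻¹ ≤ ((1 + ‖y‖) ^ n)⁻¹ * (1 + ‖x‖ + ‖y‖)⁻¹ := by
        rw [pow_succ, mul_inv]
        gcongr
        linarith [norm_nonneg x]
      have h5 : B * (1 + ‖x‖ + ‖y‖)⁻¹ < e / 2 * c' := by
        rw [← div_eq_mul_inv, div_lt_iff₀ hS]
        rw [div_lt_iff₀ (by positivity)] at hR
        nlinarith [mul_pos he hc'0]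
      calc B * ((1 + ‖x‖ + ‖y‖) ^ (n + 1))⁻¹
          ≤ B * (((1 + ‖y‖) ^ n)⁻¹ * (1 + ‖x‖ + ‖y‖)⁻¹) := by gcongr
        _ = (B * (1 + ‖x‖ + ‖y‖)⁻¹) * ((1 + ‖y‖) ^ n)⁻¹ := by ring
        _ < (e / 2 * c') * ((1 + ‖y‖) ^ n)⁻¹ := by gcongr
        _ = _ := by ring
    have h6 := mul_le_mul_of_nonneg_left hlow (half_pos he).le
    linarith
  refine ⟨fun β hβ => ?_, ?_, ?_⟩
  · rw [Metric.tendstoUniformly_iff]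
    intro e he
    obtain ⟨B, hB, hle⟩ := key (e / 2) (half_pos he)
    have hlim := (tendsto_rpow_atTop (show 0 < 1 / p by positivity)).comp
      (hΓ.tendsto_diagKernel_frontier hβ)
    filter_upwards [hlim.eventually_gt_atTop (2 * B / e), self_mem_nhdsWithin] with y hy hyΓ x
    have hkp : 0 < diagKernel Γ y ^ (1 / p) :=
      Real.rpow_pos_of_pos (hΓ.diagKernel_pos hyΓ) _
    rw [hratio, abs_of_nonneg (by positivity), div_lt_iff₀ hkp]
    have h1 : B * ((1 + ‖x‖ + ‖y‖) ^ (n + 1))⁻¹ ≤ B := by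
      refine mul_le_of_le_one_right hB (inv_le_one_of_one_le₀ (one_le_pow₀ ?_))
      linarith [norm_nonneg x, norm_nonneg y]
    simp only [Function.comp] at hy
    rw [div_lt_iff₀ he] at hy
    linarith [hle x y hyΓ]
  · rw [Metric.tendstoUniformly_iff]
    intro e he
    obtain ⟨R, hR⟩ := hrate e he
    rw [eventually_inf_principal]
    filter_upwards [tendsto_norm_cobounded_atTop.eventually_gt_atTop R] with y hy hyΓ x
    exact hR x y hyΓ (by linarith [norm_nonneg x])
  · rw [Metric.tendstoUniformlyOn_iff]
    intro e he
    obtain ⟨R, hR⟩ := hrate e he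
    filter_upwards [tendsto_norm_cobounded_atTop.eventually_gt_atTop R] with x hx y hyΓ
    exact hR x y hyΓ (by linarith [norm_nonneg y])
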